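/- **Setting.** Let $N\ge 1$, let $\Omega\subset\mathbb R^N$ be a bounded domain, let $p>1$, and let $W_0^{1,p}(\Omega)$ be normed by $\|u\|_W=\left(\int_\Omega|\nabla u|^p\right)^{1/p}$. Put $p^*=\frac{pN}{N-p}$ if $N>p$ and $p^*=\infty$ if $N\le p$. Let $M:[0,\infty)\to\mathbb R$ be integrable at $0$ and continuous on $(0,\infty)$, and put $\widehat M(t)=\int_0^tM(s)\,ds$. Let $f:\Omega\times\mathbb R\to\mathbb R$, put $F(x,v)=\int_0^vf(x,s)\,ds$, and consider $$J(u)=\frac1p\widehat M\left(\|u\|_W^p\right)-\int_\Omega F(x,u)\,dx,\qquad u\in W_0^{1,p}(\Omega).$$ A sequence $(u_n)$ in $W_0^{1,p}(\Omega)$ is a *PS sequence* for $J$ if $(J(u_n))$ is bounded, $J$ is (Fréchet) differentiable at every $u_n$, and $J'(u_n)\to0$ in the dual space. It is a *Cerami sequence* if the last requirement is strengthened to $(1+\|u_n\|_W)\,J'(u_n)\to0$. $J$ satisfies the *PS condition* (resp. the *Cerami condition*) if every PS (resp. Cerami) sequence for $J$ has a subsequence converging in the norm of $W_0^{1,p}(\Omega)$.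 **Hypotheses.** Consider the following conditions. - $(\widetilde H_1)$: $f$ is a Carathéodory function and there are $\widetilde\varpi\in(1,p^*)$ and $\widetilde C_0>0$ such that $|f(x,v)|\le\widetilde C_0(1+|v|^{\widetilde\varpi-1})$ for every $x\in\Omega$, $v\in\mathbb R$. - $(K_{AR})$: there are $\widetilde r,C,\beta>0$ such that (i) $\widetilde rF(x,v)-f(x,v)v\le C$ for every $x\in\Omega$, $v\in\mathbb R$, and (ii) $\frac{\widetilde r}p\widehat M(s^p)-M(s^p)s^p\ge\beta s-C$ for every $s\ge0$. - $(K_{AR}')$: the same as $(K_{AR})$, with (ii) replaced by the weaker condition (iii) there is $h>0$ such that $\frac{\widetilde r}p\widehat M(s^p)-M(s^p)s^p\ge\beta s^h-C$ for every $s\ge0$. - $(K_C)$: there are $\widetilde r>\widetilde\varpi$ and $C>0$ such that $\widehat M(s^p)\ge s^{\widetilde r}-C$ for every $s\ge0$. - $(K_M)$: $M(t)>0$ for every $t>0$. **Proposition.** Assume $(\widetilde H_1)$. 1. If $(K_{AR})$ or $(K_C)$ holds, then every PS sequence for $J$ is bounded in $W_0^{1,p}(\Omega)$. If moreover $(K_M)$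 holds, then $J$ satisfies the PS condition. 2. If $(K_{AR}')$ or $(K_C)$ holds, then every Cerami sequence for $J$ is bounded in $W_0^{1,p}(\Omega)$. If moreover $(K_M)$ holds, then $J$ satisfies the Cerami condition. -/

import Mathlib

open MeasureTheory Set Filter Topology
open scoped ENNReal ContDiff Gradient

namespace Kirchhoff

noncomputable section

/-- Euclidean `N`-space. -/
abbrev Space (N : ℕ) : Type := EuclideanSpace ℝ (Fin N)

/-- A bounded domain of `ℝ^N`: a nonempty, open, connected and bounded set. -/
structure BoundedDomain (N : ℕ) where
  carrier : Set (Space N)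
  isOpen : IsOpen carrier
  isConnected : IsConnected carrier
  isBounded : Bornology.IsBounded carrier

/-- Lebesgue measure on the domain. -/
abbrev BoundedDomain.measure {N : ℕ} (Ω : BoundedDomain N) : Measure (Space N) :=
  volume.restrict Ω.carrier

/-- `φ ∈ C_c^∞(Ω)`. -/
structure IsTestFunction {N : ℕ} (Ω : BoundedDomain N) (φ : Space N → ℝ) : Prop where
  smooth : ContDiff ℝ ∞ φ
  compact : HasCompactSupport φ
  support : tsupport φ ⊆ Ω.carrier

instance fact_one_le_ofReal (p : ℝ) [hp : Fact (1 < p)] : Fact (1 ≤ ENNReal.ofReal p) :=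
  ⟨ENNReal.one_le_ofReal.2 hp.out.le⟩

/-- The real Banach space `L^p(Ω; E)`. -/
abbrev LpOn {N : ℕ} (Ω : BoundedDomain N) (p : ℝ) (E : Type) [NormedAddCommGroup E] : Type :=
  Lp E (ENNReal.ofReal p) Ω.measure

section Sobolev

variable {N : ℕ} (Ω : BoundedDomain N) (p : ℝ)

theorem differentiable_of_isTestFunction {φ : Space N → ℝ} (hφ : IsTestFunction Ω φ) :
    Differentiable ℝ φ :=
  hφ.smooth.differentiable (by simp)

theorem gradient_add_test {φ ψ : Space N → ℝ} (hφ : IsTestFunction Ω φ)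
    (hψ : IsTestFunction Ω ψ) (x : Space N) :
    ∇ (fun y => φ y + ψ y) x = ∇ φ x + ∇ ψ x := by
  have h1 := differentiable_of_isTestFunction Ω hφ x
  have h2 := differentiable_of_isTestFunction Ω hψ x
  simp only [gradient]
  rw [fderiv_fun_add h1 h2, map_add]

theorem gradient_smul_test (c : ℝ) {φ : Space N → ℝ} (hφ : IsTestFunction Ω φ) (x : Space N) :
    ∇ (fun y => c * φ y) x = c • ∇ φ x := by
  have h1 := differentiable_of_isTestFunction Ω hφ x
  simp only [gradient]
  rw [fderiv_const_mul h1, map_smul]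

/-- The pairs `(φ, ∇φ)`, `φ ∈ C_c^∞(Ω)`, inside `L^p(Ω) × L^p(Ω; ℝ^N)`. -/
def testPairs : Submodule ℝ (LpOn Ω p ℝ × LpOn Ω p (Space N)) where
  carrier := {w | ∃ φ : Space N → ℝ, IsTestFunction Ω φ ∧
    w.1 =ᵐ[Ω.measure] φ ∧ w.2 =ᵐ[Ω.measure] ∇ φ}
  zero_mem' := by
    refine ⟨fun _ => 0, ⟨contDiff_const, HasCompactSupport.zero, by simp [tsupport]⟩, ?_, ?_⟩
    · exact Lp.coeFn_zero _ _ _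
    · have h : ∇ (fun _ : Space N => (0 : ℝ)) = 0 := by
        funext x
        simp [gradient]
      rw [h]
      exact Lp.coeFn_zero _ _ _
  add_mem' := by
    rintro v w ⟨φ, hφ, h1, h2⟩ ⟨ψ, hψ, h3, h4⟩
    refine ⟨fun x => φ x + ψ x, ⟨hφ.smooth.add hψ.smooth, hφ.compact.add hψ.compact, ?_⟩, ?_, ?_⟩
    · exact (tsupport_add φ ψ).trans (union_subset hφ.support hψ.support)
    · filter_upwards [Lp.coeFn_add v.1 w.1, h1, h3] with x a b c
      simp only [Prod.fst_add]
      rw [a, Pi.add_apply, b, c]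
    · filter_upwards [Lp.coeFn_add v.2 w.2, h2, h4] with x a b c
      simp only [Prod.snd_add]
      rw [a, Pi.add_apply, b, c, gradient_add_test Ω hφ hψ]
  smul_mem' := by
    rintro c v ⟨φ, hφ, h1, h2⟩
    refine ⟨fun x => c * φ x, ⟨contDiff_const.mul hφ.smooth, hφ.compact.mul_left, ?_⟩, ?_, ?_⟩
    · exact (closure_mono (Function.support_mul_subset_right _ _)).trans hφ.support
    · filter_upwards [Lp.coeFn_smul c v.1, h1] with x a b
      simp only [Prod.smul_fst]
      rw [a, Pi.smul_apply, b, smul_eq_mul]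
    · filter_upwards [Lp.coeFn_smul c v.2, h2] with x a b
      simp only [Prod.smul_snd]
      rw [a, Pi.smul_apply, b, gradient_smul_test Ω c hφ]

theorem gradient_support {φ : Space N → ℝ} (hφ : IsTestFunction Ω φ) {x : Space N}
    (hx : x ∉ Ω.carrier) : φ x = 0 ∧ ∇ φ x = 0 := by
  have h : x ∉ tsupport φ := fun h => hx (hφ.support h)
  refine ⟨image_eq_zero_of_notMem_tsupport h, ?_⟩
  have : fderiv ℝ φ x = 0 := by
    by_contra h'
    exact h (support_fderiv_subset ℝ h')
  simp [gradient, this]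

set_option maxHeartbeats 1000000 in
/-- Poincaré's inequality for test functions. -/
theorem exists_poincare_test [NeZero N] [hp : Fact (1 < p)] :
    ∃ R : ℝ, 0 < R ∧ ∀ φ : Space N → ℝ, IsTestFunction Ω φ →
      eLpNorm φ (ENNReal.ofReal p) Ω.measure ≤
        ENNReal.ofReal R * eLpNorm (∇ φ) (ENNReal.ofReal p) Ω.measure := by
  have hp1 : 1 < p := hp.out
  have hp0 : 0 < p := by linarith
  obtain ⟨r, hr0, hr⟩ := Ω.isBounded.subset_ball_lt 0 (0 : Space N)
  set R : ℝ := 2 * r with hR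
  have hR0 : 0 < R := by positivity
  refine ⟨R, hR0, fun φ hφ => ?_⟩
  set e : Space N := EuclideanSpace.single (0 : Fin N) (1 : ℝ) with he
  have hen : ‖e‖ = 1 := by simp [he]
  have hcont : Continuous (∇ φ) := by
    have : Continuous (fderiv ℝ φ) := hφ.smooth.continuous_fderiv (by simp)
    exact (InnerProductSpace.toDual ℝ (Space N)).symm.continuous.comp this
  have hdiff := differentiable_of_isTestFunction Ω hφ
  have hderiv (x : Space N) (t : ℝ) :
      HasDerivAt (fun t : ℝ => φ (x + t • e)) (inner ℝ (∇ φ (x + t • e)) e) t := by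
    have h1 : HasDerivAt (fun t : ℝ => x + t • e) e t := by
      simpa using ((hasDerivAt_id t).smul_const e).const_add x
    have h2 := (hdiff (x + t • e)).hasFDerivAt.comp_hasDerivAt t h1
    rw [inner_gradient_left]
    exact h2
  set ν : Measure ℝ := volume.restrict (Ioc 0 R) with hν
  have hνu : ν univ = ENNReal.ofReal R := by simp [hν]
  have hpt (x : Space N) (hx : x ∈ Ω.carrier) :
      ‖φ x‖ₑ ≤ ∫⁻ t, ‖∇ φ (x + t • e)‖ₑ ∂ν := by
    have hx' : x + R • e ∉ Ω.carrier := by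
      intro h
      have h1 := mem_ball_zero_iff.1 (hr hx)
      have h2 := mem_ball_zero_iff.1 (hr h)
      have h3 : ‖R • e‖ ≤ ‖x + R • e‖ + ‖x‖ := by
        simpa using norm_sub_le (x + R • e) x
      rw [norm_smul, hen, Real.norm_of_nonneg hR0.le] at h3
      linarith
    have hc : Continuous fun t : ℝ => (inner ℝ (∇ φ (x + t • e)) e : ℝ) := by fun_prop
    have hI := intervalIntegral.integral_eq_sub_of_hasDerivAt (a := 0) (b := R)
      (fun t _ => hderiv x t) (hc.intervalIntegrable _ _)
    rw [(gradient_support Ω hφ hx').1] at hI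
    have : φ x = - ∫ t in (0 : ℝ)..R, (inner ℝ (∇ φ (x + t • e)) e : ℝ) := by
      rw [hI]; simp
    rw [this, enorm_neg, intervalIntegral.integral_of_le hR0.le]
    refine (enorm_integral_le_lintegral_enorm _).trans (lintegral_mono fun t => ?_)
    rw [enorm_le_iff_norm_le]
    simpa [hen] using norm_inner_le_norm (𝕜 := ℝ) (∇ φ (x + t • e)) e
  have hjen (x : Space N) : (∫⁻ t, ‖∇ φ (x + t • e)‖ₑ ∂ν) ^ p ≤
      ENNReal.ofReal R ^ (p - 1) * ∫⁻ t, ‖∇ φ (x + t • e)‖ₑ ^ p ∂ν := by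
    have hm : AEStronglyMeasurable (fun t : ℝ => ∇ φ (x + t • e)) ν :=
      (by fun_prop : Continuous fun t : ℝ => ∇ φ (x + t • e)).aestronglyMeasurable
    have h := eLpNorm'_le_eLpNorm'_mul_rpow_measure_univ one_pos hp1.le hm
    simp only [eLpNorm', ENNReal.rpow_one, div_one] at h
    rw [hνu] at h
    refine (ENNReal.rpow_le_rpow h hp0.le).trans_eq ?_
    rw [ENNReal.mul_rpow_of_nonneg _ _ hp0.le, ← ENNReal.rpow_mul, ← ENNReal.rpow_mul,
      one_div, inv_mul_cancel₀ hp0.ne', ENNReal.rpow_one, mul_comm]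
    congr 2
    field_simp
  have hfull (g : Space N → ℝ≥0∞) (hg : ∀ x ∉ Ω.carrier, g x = 0) :
      ∫⁻ x in Ω.carrier, g x = ∫⁻ x, g x := by
    rw [← lintegral_indicator Ω.isOpen.measurableSet]
    refine lintegral_congr fun x => ?_
    by_cases hx : x ∈ Ω.carrier
    · simp [hx]
    · simp [hx, hg x hx]
  have hmain : ∫⁻ x in Ω.carrier, ‖φ x‖ₑ ^ p ≤
      ENNReal.ofReal R ^ p * ∫⁻ x in Ω.carrier, ‖∇ φ x‖ₑ ^ p := by
    have hmeas : Measurable fun z : Space N × ℝ => ‖∇ φ (z.1 + z.2 • e)‖ₑ ^ p :=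
      ((by fun_prop : Continuous fun z : Space N × ℝ =>
        ∇ φ (z.1 + z.2 • e)).measurable.enorm).pow_const p
    calc ∫⁻ x in Ω.carrier, ‖φ x‖ₑ ^ p
        ≤ ∫⁻ x in Ω.carrier,
            ENNReal.ofReal R ^ (p - 1) * ∫⁻ t, ‖∇ φ (x + t • e)‖ₑ ^ p ∂ν := by
          refine setLIntegral_mono' Ω.isOpen.measurableSet fun x hx => ?_
          exact (ENNReal.rpow_le_rpow (hpt x hx) hp0.le).trans (hjen x)
      _ ≤ ∫⁻ x, ENNReal.ofReal R ^ (p - 1) * ∫⁻ t, ‖∇ φ (x + t • e)‖ₑ ^ p ∂ν :=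
          setLIntegral_le_lintegral _ _
      _ = ENNReal.ofReal R ^ (p - 1) * ∫⁻ x, ∫⁻ t, ‖∇ φ (x + t • e)‖ₑ ^ p ∂ν := by
          rw [lintegral_const_mul' _ _
            (ENNReal.rpow_ne_top_of_nonneg (by linarith) ENNReal.ofReal_ne_top)]
      _ = ENNReal.ofReal R ^ (p - 1) * ∫⁻ t, (∫⁻ x, ‖∇ φ (x + t • e)‖ₑ ^ p) ∂ν := by
          rw [lintegral_lintegral_swap hmeas.aemeasurable]
      _ = ENNReal.ofReal R ^ (p - 1) * ∫⁻ _t : ℝ, (∫⁻ x, ‖∇ φ x‖ₑ ^ p) ∂ν := by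
          congr 1
          refine lintegral_congr fun t => ?_
          exact lintegral_add_right_eq_self (fun x => ‖∇ φ x‖ₑ ^ p) (t • e)
      _ = ENNReal.ofReal R ^ p * ∫⁻ x in Ω.carrier, ‖∇ φ x‖ₑ ^ p := by
          rw [lintegral_const, hνu, mul_comm _ (ENNReal.ofReal R), ← mul_assoc,
            hfull _ fun x hx => by simp [(gradient_support Ω hφ hx).2, hp0]]
          congr 1
          have hRne : ENNReal.ofReal R ≠ 0 := by simpa using hR0
          conv_rhs => rw [← sub_add_cancel p 1,
            ENNReal.rpow_add _ _ hRne ENNReal.ofReal_ne_top, ENNReal.rpow_one]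
  have hq0 : ENNReal.ofReal p ≠ 0 := by simpa using hp0
  rw [eLpNorm_eq_lintegral_rpow_enorm_toReal hq0 ENNReal.ofReal_ne_top,
    eLpNorm_eq_lintegral_rpow_enorm_toReal hq0 ENNReal.ofReal_ne_top,
    ENNReal.toReal_ofReal hp0.le]
  refine (ENNReal.rpow_le_rpow hmain (by positivity)).trans_eq ?_
  rw [ENNReal.mul_rpow_of_nonneg _ _ (by positivity), ← ENNReal.rpow_mul,
    mul_one_div_cancel hp0.ne', ENNReal.rpow_one]

variable [Fact (1 < p)]

/-- The Sobolev space `W_0^{1,p}(Ω)`, that is, the closure of `C_c^∞(Ω)` in `W^{1,p}(Ω)`: an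
element is a pair `(u, ∇u)` of a function and its (weak) gradient, and lies in the closure of the
pairs `(φ, ∇φ)`, `φ ∈ C_c^∞(Ω)`, in `L^p(Ω) × L^p(Ω; ℝ^N)`. -/
def W0 : Type := ↥((testPairs Ω p).topologicalClosure)

instance : AddCommGroup (W0 Ω p) :=
  inferInstanceAs (AddCommGroup ↥((testPairs Ω p).topologicalClosure))

instance : Module ℝ (W0 Ω p) :=
  inferInstanceAs (Module ℝ ↥((testPairs Ω p).topologicalClosure))

variable {Ω p}

/-- The function `u ∈ L^p(Ω)` underlying an element of `W_0^{1,p}(Ω)`. -/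
def W0.toLp (u : W0 Ω p) : LpOn Ω p ℝ := u.1.1

instance : CoeFun (W0 Ω p) (fun _ => Space N → ℝ) := ⟨fun u => (u.toLp : Space N → ℝ)⟩

variable (Ω p)

/-- The gradient `∇u ∈ L^p(Ω; ℝ^N)`, as a linear map of `u ∈ W_0^{1,p}(Ω)`. -/
def W0.grad : W0 Ω p →ₗ[ℝ] LpOn Ω p (Space N) :=
  (LinearMap.snd ℝ (LpOn Ω p ℝ) (LpOn Ω p (Space N))).comp
    ((testPairs Ω p).topologicalClosure).subtype

/-- Poincaré's inequality on `W_0^{1,p}(Ω)`. -/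
theorem W0.exists_poincare [NeZero N] :
    ∃ R : ℝ, 0 < R ∧ ∀ u : W0 Ω p, ‖u.toLp‖ ≤ R * ‖W0.grad Ω p u‖ := by
  obtain ⟨R, hR0, hR⟩ := exists_poincare_test Ω p
  refine ⟨R, hR0, fun u => ?_⟩
  have hcl : IsClosed {w : LpOn Ω p ℝ × LpOn Ω p (Space N) | ‖w.1‖ ≤ R * ‖w.2‖} :=
    isClosed_le (by fun_prop) (by fun_prop)
  refine (closure_minimal ?_ hcl) u.2
  rintro w ⟨φ, hφ, h1, h2⟩
  have h := hR φ hφ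
  rw [← eLpNorm_congr_ae h1, ← eLpNorm_congr_ae h2] at h
  have h' := ENNReal.toReal_mono
    (ENNReal.mul_ne_top ENNReal.ofReal_ne_top (Lp.eLpNorm_ne_top w.2)) h
  rw [ENNReal.toReal_mul, ENNReal.toReal_ofReal hR0.le] at h'
  simpa [Lp.norm_def] using h'

theorem W0.grad_injective [NeZero N] : Function.Injective (W0.grad Ω p) := by
  rw [← LinearMap.ker_eq_bot, LinearMap.ker_eq_bot']
  intro u hu
  obtain ⟨R, -, hR⟩ := W0.exists_poincare Ω p
  have h1 : u.toLp = 0 := by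
    have := hR u
    rw [hu, norm_zero, mul_zero] at this
    exact norm_le_zero_iff.1 this
  exact Subtype.ext (Prod.ext h1 hu)

/-- `W_0^{1,p}(Ω)` carries the norm `‖u‖_W = (∫_Ω |∇u|^p)^{1/p}`. -/
instance [NeZero N] : NormedAddCommGroup (W0 Ω p) :=
  NormedAddCommGroup.induced (W0 Ω p) (LpOn Ω p (Space N)) (W0.grad Ω p)
    (W0.grad_injective Ω p)

instance [NeZero N] : NormedSpace ℝ (W0 Ω p) :=
  NormedSpace.induced ℝ (W0 Ω p) (LpOn Ω p (Space N)) (W0.grad Ω p)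

theorem W0.norm_rpow_eq [NeZero N] (u : W0 Ω p) :
    ‖u‖ ^ p = ∫ x in Ω.carrier, ‖W0.grad Ω p u x‖ ^ p := by
  have hp0 : 0 < p := zero_lt_one.trans (Fact.out : 1 < p)
  have h := (Lp.memLp (W0.grad Ω p u)).eLpNorm_eq_integral_rpow_norm (by simpa using hp0)
    ENNReal.ofReal_ne_top
  rw [ENNReal.toReal_ofReal hp0.le] at h
  have h0 : 0 ≤ ∫ x in Ω.carrier, ‖W0.grad Ω p u x‖ ^ p :=
    integral_nonneg fun x => by positivity
  change ‖W0.grad Ω p u‖ ^ p = _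
  rw [Lp.norm_def, h, ENNReal.toReal_ofReal (by positivity), ← Real.rpow_mul h0,
    inv_mul_cancel₀ hp0.ne', Real.rpow_one]

end Sobolev

section Compactness

variable {X : Type*} [NormedAddCommGroup X] [NormedSpace ℝ X]

/-- `(u_n)` is a Palais-Smale sequence of `J`: `J(u_n)` is bounded and `J'(u_n) → 0` in the dual
space, `J'` being the Fréchet derivative (which has to exist at each `u_n`). -/
def IsPSSequence (J : X → ℝ) (u : ℕ → X) : Prop :=
  (∃ C : ℝ, ∀ n, |J (u n)| ≤ C) ∧ (∀ n, DifferentiableAt ℝ J (u n)) ∧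
    Tendsto (fun n => ‖fderiv ℝ J (u n)‖) atTop (𝓝 0)

/-- `(u_n)` is a Cerami sequence of `J`: `J(u_n)` is bounded and `(1 + ‖u_n‖) J'(u_n) → 0`. -/
def IsCeramiSequence (J : X → ℝ) (u : ℕ → X) : Prop :=
  (∃ C : ℝ, ∀ n, |J (u n)| ≤ C) ∧ (∀ n, DifferentiableAt ℝ J (u n)) ∧
    Tendsto (fun n => (1 + ‖u n‖) * ‖fderiv ℝ J (u n)‖) atTop (𝓝 0)

/-- The sequence `u` has a (norm-)convergent subsequence. -/
def HasConvergentSubsequence (u : ℕ → X) : Prop :=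
  ∃ (v : X) (φ : ℕ → ℕ), StrictMono φ ∧ Tendsto (u ∘ φ) atTop (𝓝 v)

def PSCondition (J : X → ℝ) : Prop :=
  ∀ u : ℕ → X, IsPSSequence J u → HasConvergentSubsequence u

def CeramiCondition (J : X → ℝ) : Prop :=
  ∀ u : ℕ → X, IsCeramiSequence J u → HasConvergentSubsequence u

end Compactness

section Functional

/-- The critical exponent `p^*`: `pN/(N-p)` for `p < N`, and `∞` for `p ≥ N`. -/
def criticalExponent (N : ℕ) (p : ℝ) : EReal :=
  if p < N then ((p * N / (N - p) : ℝ) : EReal) else ⊤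

/-- A primitive vanishing at `0`, `t ↦ ∫_0^t g(s) ds`. -/
def primitive (g : ℝ → ℝ) (t : ℝ) : ℝ := ∫ s in (0 : ℝ)..t, g s

/-- The functional `J(u) = (1/p) M̂(‖u‖_W^p) - ∫_Ω F(x,u)` on `W_0^{1,p}(Ω)`, where
`M̂(t) = ∫_0^t M(s) ds` and `F(x,v) = ∫_0^v f(x,s) ds`. -/
def energy {N : ℕ} [NeZero N] (Ω : BoundedDomain N) (p : ℝ) [Fact (1 < p)]
    (M : ℝ → ℝ) (f : Space N → ℝ → ℝ) (u : W0 Ω p) : ℝ :=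
  1 / p * primitive M (‖u‖ ^ p) - ∫ x in Ω.carrier, primitive (f x) (u x)

/-- `M` (of which only the values on `[0,∞)` matter) is integrable at `0` and continuous on
`(0,∞)`. -/
structure IsKirchhoffCoefficient (M : ℝ → ℝ) : Prop where
  integrable : IntervalIntegrable M volume 0 1
  continuousOn : ContinuousOn M (Ioi 0)

/-- `f : Ω × ℝ → ℝ` is a Carathéodory function: (Lebesgue) measurable in `x`, continuous in `v`
for almost every `x`. -/
structure IsCaratheodory {N : ℕ} (Ω : BoundedDomain N) (f : Space N → ℝ → ℝ) : Prop where
  measurable : ∀ v : ℝ, AEMeasurable (fun x => f x v) Ω.measure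
  continuous : ∀ᵐ x ∂Ω.measure, Continuous (f x)

/-- `f` is Carathéodory with subcritical growth of exponent `ϖ - 1`, where `1 < ϖ < p^*`. -/
structure SubcriticalGrowth {N : ℕ} (Ω : BoundedDomain N) (p : ℝ) (f : Space N → ℝ → ℝ)
    (ϖ : ℝ) : Prop where
  caratheodory : IsCaratheodory Ω f
  one_lt : 1 < ϖ
  lt_critical : (ϖ : EReal) < criticalExponent N p
  growth : ∃ C₀ : ℝ, 0 < C₀ ∧ ∀ x ∈ Ω.carrier, ∀ v : ℝ, |f x v| ≤ C₀ * (1 + |v| ^ (ϖ - 1))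

/-- The Ambrosetti-Rabinowitz type condition `K_AR` (parts (i) and (ii)). -/
def ConditionAR {N : ℕ} (Ω : BoundedDomain N) (p : ℝ) (M : ℝ → ℝ) (f : Space N → ℝ → ℝ) : Prop :=
  ∃ r C β : ℝ, 0 < r ∧ 0 < C ∧ 0 < β ∧
    (∀ x ∈ Ω.carrier, ∀ v : ℝ, r * primitive (f x) v - f x v * v ≤ C) ∧
    (∀ s : ℝ, 0 ≤ s → r / p * primitive M (s ^ p) - M (s ^ p) * s ^ p ≥ β * s - C)

/-- The weakening of `K_AR` in which part (ii) is replaced by part (iii). -/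
def ConditionARWeak {N : ℕ} (Ω : BoundedDomain N) (p : ℝ) (M : ℝ → ℝ)
    (f : Space N → ℝ → ℝ) : Prop :=
  ∃ r C β : ℝ, 0 < r ∧ 0 < C ∧ 0 < β ∧
    (∀ x ∈ Ω.carrier, ∀ v : ℝ, r * primitive (f x) v - f x v * v ≤ C) ∧
    (∃ h : ℝ, 0 < h ∧
      ∀ s : ℝ, 0 ≤ s → r / p * primitive M (s ^ p) - M (s ^ p) * s ^ p ≥ β * s ^ h - C)

/-- The coercivity condition `K_C`, relative to the growth exponent `ϖ` of `f`. -/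
def ConditionC (p : ℝ) (M : ℝ → ℝ) (ϖ : ℝ) : Prop :=
  ∃ r C : ℝ, ϖ < r ∧ 0 < C ∧ ∀ s : ℝ, 0 ≤ s → primitive M (s ^ p) ≥ s ^ r - C

end Functional

end

end Kirchhoff

/-! Boundedness. Under `ConditionC` the term `M̂(‖u‖ ^ p)` grows faster than `‖u‖ ^ ϖ`, which
controls `∫ F(x,u)` by the Sobolev embedding, so `J` is coercive. Under the Ambrosetti-Rabinowitz
conditions, `r J(u) - J'(u)u` bounds `(r/p) M̂(‖u‖ ^ p) - M(‖u‖ ^ p) ‖u‖ ^ p` from above, up to a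
constant. Along a PS sequence `J'(u)u` is `o(‖u‖)` and is absorbed by the linear growth `β ‖u‖`;
along a Cerami sequence it tends to `0`, so any positive power of `‖u‖` is enough.

Compactness. A bounded sequence has a subsequence `w` that is Cauchy in `L¹`
(`W0.exists_subseq_cauchy`) and whose norms converge to some `ℓ`. If `ℓ = 0`, then `w → 0`, and the
behaviour of `M` at `0` plays no role. If `ℓ > 0`, then `M(‖w_m‖ ^ p)` stays away from `0`. The
integral of `f(x,w_m)(w_n - w_m)` is small, because `w_n - w_m` is small in `L¹` while `w` is
bounded in `L^q` for some `q` between `ϖ` and `p^*`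
(`SubcriticalGrowth.exists_abs_integral_mul_le`). As `J'(w_m) → 0`, the norm term has almost zero
derivative at `w_m` in the direction `w_n - w_m`. Convexity of `‖·‖ ^ p` and monotonicity of `M̂`
then show that the midpoint of `w_m` and `w_n` has a `p`-th power of the norm hardly below `‖w_m‖ ^
p` (`SubcriticalGrowth.norm_rpow_sub_midpoint_le`), and by symmetry hardly below `‖w_n‖ ^ p`.
Uniform convexity makes `w` Cauchy (`W0.exists_uniform_convexity`). This needs neither a weak limit
nor a formula for the derivative of the norm in general directions. -/

namespace Kirchhoff

/-! ### Sobolev inequalities for test functions -/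

section TestFunctions

variable {N : ℕ} {Ω : BoundedDomain N} {p q : ℝ}

instance BoundedDomain.isFiniteMeasure (Ω : BoundedDomain N) : IsFiniteMeasure Ω.measure :=
  ⟨by simpa using Ω.isBounded.measure_lt_top⟩

theorem IsTestFunction.continuous_gradient {φ : Space N → ℝ} (hφ : IsTestFunction Ω φ) :
    Continuous (∇ φ) :=
  (InnerProductSpace.toDual ℝ (Space N)).symm.continuous.comp
    (hφ.smooth.continuous_fderiv (by simp))

theorem enorm_gradient (φ : Space N → ℝ) (x : Space N) : ‖∇ φ x‖ₑ = ‖fderiv ℝ φ x‖ₑ := by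
  simp only [gradient, ← ofReal_norm, LinearIsometryEquiv.norm_map]

theorem IsTestFunction.support_subset {φ : Space N → ℝ} (hφ : IsTestFunction Ω φ) :
    Function.support φ ⊆ Ω.carrier := (subset_tsupport φ).trans hφ.support

theorem IsTestFunction.support_gradient_subset {φ : Space N → ℝ} (hφ : IsTestFunction Ω φ) :
    Function.support (∇ φ) ⊆ Ω.carrier := fun x hx => by
  by_contra h
  exact hx (gradient_support Ω hφ h).2

theorem IsTestFunction.enorm_add_smul_sub_le {φ : Space N → ℝ} (hφ : IsTestFunction Ω φ)
    (x e : Space N) {R : ℝ} (hR : 0 ≤ R) :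
    ‖φ (x + R • e) - φ x‖ₑ ≤ ∫⁻ t in Icc (0 : ℝ) R, ‖∇ φ (x + t • e)‖ₑ * ‖e‖ₑ := by
  have hs : ContDiff ℝ 1 fun t : ℝ => φ (x + t • e) :=
    (hφ.smooth.of_le (by simp)).comp (by fun_prop)
  have h := enorm_sub_le_lintegral_deriv_of_contDiffOn_Icc (f := fun t : ℝ => φ (x + t • e))
    hs.contDiffOn hR
  simp only [zero_smul, add_zero] at h
  refine h.trans (lintegral_mono fun t => ?_)
  have h1 : HasDerivAt (fun t : ℝ => x + t • e) e t := by
    simpa using ((hasDerivAt_id t).smul_const e).const_add x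
  have h2 := (differentiable_of_isTestFunction Ω hφ (x + t • e)).hasFDerivAt.comp_hasDerivAt t h1
  have h3 : deriv (fun t : ℝ => φ (x + t • e)) t = fderiv ℝ φ (x + t • e) e := h2.deriv
  rw [h3, enorm_gradient]
  exact (fderiv ℝ φ (x + t • e)).le_opENorm e

theorem IsTestFunction.eLpNorm_gradient_univ {φ : Space N → ℝ} (hφ : IsTestFunction Ω φ)
    (r : ℝ≥0∞) : eLpNorm (∇ φ) r volume = eLpNorm (∇ φ) r Ω.measure :=
  (eLpNorm_restrict_eq_of_support_subset hφ.support_gradient_subset).symm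

/-- Hölder's inequality on a set of finite measure. The constant is chosen before the target space,
so that it serves functions and gradients alike. -/
theorem eLpNorm_le_mul_of_le (Ω : BoundedDomain N) {r s : ℝ≥0∞} (hr : 1 ≤ r) (hrs : r ≤ s) :
    ∃ K : ℝ, 0 ≤ K ∧ ∀ {E : Type} [NormedAddCommGroup E] (g : Space N → E),
      AEStronglyMeasurable g Ω.measure →
      eLpNorm g r Ω.measure ≤ ENNReal.ofReal K * eLpNorm g s Ω.measure := by
  refine ⟨(Ω.measure univ ^ (1 / r.toReal - 1 / s.toReal)).toReal, ENNReal.toReal_nonneg,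
    fun g hg => ?_⟩
  refine (eLpNorm_le_eLpNorm_mul_rpow_measure_univ hrs hg).trans_eq ?_
  rw [mul_comm, ENNReal.ofReal_toReal]
  refine ENNReal.rpow_ne_top_of_nonneg ?_ (measure_ne_top _ _)
  rw [sub_nonneg]
  by_cases hs : s = ⊤
  · simp [hs]
  · have hr' : r ≠ ⊤ := (hrs.trans_lt (lt_top_iff_ne_top.2 hs)).ne
    exact one_div_le_one_div_of_le (ENNReal.toReal_pos (zero_lt_one.trans_le hr).ne' hr')
      (ENNReal.toReal_mono hs hrs)

/-- The Gagliardo-Nirenberg-Sobolev inequality with an auxiliary exponent `s < N`, followed by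
Hölder's inequality from `s` up to `p`. The detour through `s` also covers `p ≥ N`. -/
theorem exists_sobolev_test_of_two_le (Ω : BoundedDomain N) (hN : 2 ≤ N) (hp : 1 < p)
    (hq : 1 ≤ q) (hqp : (q : EReal) < criticalExponent N p) :
    ∃ K : ℝ, 0 ≤ K ∧ ∀ φ : Space N → ℝ, IsTestFunction Ω φ →
      eLpNorm φ (ENNReal.ofReal q) Ω.measure ≤
        ENNReal.ofReal K * eLpNorm (∇ φ) (ENNReal.ofReal p) Ω.measure := by
  have hN' : (2 : ℝ) ≤ N := by exact_mod_cast hN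
  have hq0 : 0 < q := by linarith
  -- `q N / (q + N)` is the exponent whose Sobolev conjugate is `q`. The maximum keeps `1 ≤ s`, and
  -- then `s < N` needs `N ≥ 2`; subcriticality of `q` gives `s ≤ p`.
  set s : ℝ := max 1 (q * N / (q + N)) with hs
  have hs1 : 1 ≤ s := le_max_left _ _
  have hsN : s < N := by
    refine max_lt (by linarith) ?_
    rw [div_lt_iff₀ (by linarith)]
    nlinarith
  have hsp : s ≤ p := by
    refine max_le hp.le ?_
    rw [div_le_iff₀ (by linarith)]
    unfold criticalExponent at hqp
    split_ifs at hqp with h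
    · have h1 : q < p * N / (N - p) := by exact_mod_cast hqp
      rw [lt_div_iff₀ (by linarith)] at h1
      nlinarith
    · push Not at h
      nlinarith
  obtain ⟨K, hK0, hK⟩ := eLpNorm_le_mul_of_le Ω (r := ENNReal.ofReal s) (s := ENNReal.ofReal p)
    (by simpa using hs1) (ENNReal.ofReal_le_ofReal hsp)
  refine ⟨(eLpNormLESNormFDerivOfLeConst ℝ (volume : Measure (Space N)) Ω.carrier
    s.toNNReal q.toNNReal : ℝ) * K, by positivity, fun φ hφ => ?_⟩
  have hinv : (s.toNNReal : ℝ)⁻¹ - (Module.finrank ℝ (Space N) : ℝ)⁻¹ ≤ (q.toNNReal : ℝ)⁻¹ := by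
    rw [Real.coe_toNNReal _ (by linarith), Real.coe_toNNReal _ hq0.le, finrank_euclideanSpace,
      Fintype.card_fin, sub_le_iff_le_add]
    have : q⁻¹ + (N : ℝ)⁻¹ = (q * N / (q + N))⁻¹ := by
      field_simp
      ring
    rw [this]
    exact inv_anti₀ (by positivity) (le_max_right _ _)
  have h := eLpNorm_le_eLpNorm_fderiv_of_le (volume : Measure (Space N)) (F := ℝ) (u := φ)
    (p := s.toNNReal) (q := q.toNNReal) (hφ.smooth.of_le (by simp)) hφ.support_subset
    (by simpa using hs1)
    (by
      rw [finrank_euclideanSpace, Fintype.card_fin]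
      exact_mod_cast (Real.toNNReal_lt_iff_lt_coe (by linarith)).2 (by simpa using hsN))
    hinv Ω.isBounded
  have h2 : eLpNorm (fderiv ℝ φ) (s.toNNReal : ℝ≥0∞) volume =
      eLpNorm (∇ φ) (ENNReal.ofReal s) Ω.measure := by
    rw [← hφ.eLpNorm_gradient_univ]
    exact eLpNorm_congr_enorm_ae (ae_of_all _ fun x => (enorm_gradient φ x).symm)
  rw [h2] at h
  refine ((eLpNorm_restrict_le φ _ volume _).trans h).trans ?_
  rw [ENNReal.ofReal_mul (by positivity), mul_assoc, ENNReal.ofReal_coe_nnreal]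
  gcongr
  exact hK _ hφ.continuous_gradient.aestronglyMeasurable

theorem lintegral_line_eq (x : Space 1) {g : Space 1 → ℝ≥0∞} (hg : Measurable g) :
    ∫⁻ t : ℝ, g (x + t • EuclideanSpace.single (0 : Fin 1) (1 : ℝ)) = ∫⁻ y, g y := by
  have h1 : MeasurePreserving (fun t : ℝ => (WithLp.toLp 2 (fun _ : Fin 1 => t) : Space 1)) :=
    (PiLp.volume_preserving_toLp (Fin 1)).comp (volume_preserving_funUnique (Fin 1) ℝ).symm
  rw [← lintegral_add_left_eq_self g x, ← h1.lintegral_comp (by fun_prop)]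
  refine lintegral_congr fun t => ?_
  congr 2
  ext i
  fin_cases i
  simp

/-- In dimension one no exponent satisfies `1 ≤ s < N`. Instead the supremum of `φ` is at most the
`L¹` norm of its derivative, by integrating along the line to a point outside `Ω`. -/
theorem exists_sobolev_test_one (Ω : BoundedDomain 1) (hp : 1 < p) (hq : 1 ≤ q) :
    ∃ K : ℝ, 0 ≤ K ∧ ∀ φ : Space 1 → ℝ, IsTestFunction Ω φ →
      eLpNorm φ (ENNReal.ofReal q) Ω.measure ≤
        ENNReal.ofReal K * eLpNorm (∇ φ) (ENNReal.ofReal p) Ω.measure := by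
  obtain ⟨r, hr0, hr⟩ := Ω.isBounded.subset_ball_lt 0 (0 : Space 1)
  set e : Space 1 := EuclideanSpace.single (0 : Fin 1) (1 : ℝ) with he
  have hen : ‖e‖ = 1 := by simp [he]
  have hene : ‖e‖ₑ = 1 := by rw [← ofReal_norm, hen, ENNReal.ofReal_one]
  have hsup (φ : Space 1 → ℝ) (hφ : IsTestFunction Ω φ) (x : Space 1) :
      ‖φ x‖ₑ ≤ eLpNorm (∇ φ) 1 Ω.measure := by
    by_cases hx : x ∈ Ω.carrier
    · have hx' : x + (2 * r) • e ∉ Ω.carrier := by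
        intro h
        have h1 := mem_ball_zero_iff.1 (hr hx)
        have h2 := mem_ball_zero_iff.1 (hr h)
        have h3 : ‖(2 * r) • e‖ ≤ ‖x + (2 * r) • e‖ + ‖x‖ := by
          simpa using norm_sub_le (x + (2 * r) • e) x
        rw [norm_smul, hen, Real.norm_of_nonneg (by positivity)] at h3
        linarith
      have h := hφ.enorm_add_smul_sub_le x e (R := 2 * r) (by positivity)
      rw [(gradient_support Ω hφ hx').1, zero_sub, enorm_neg] at h
      refine h.trans ((setLIntegral_le_lintegral _ _).trans ?_)
      simp only [hene, mul_one]
      rw [lintegral_line_eq x (g := fun y => ‖∇ φ y‖ₑ) hφ.continuous_gradient.measurable.enorm,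
        ← hφ.eLpNorm_gradient_univ, eLpNorm_one_eq_lintegral_enorm]
    · simp [(gradient_support Ω hφ hx).1]
  obtain ⟨K, hK0, hK⟩ := eLpNorm_le_mul_of_le Ω (r := 1) (s := ENNReal.ofReal p) le_rfl
    (by simpa using hp.le)
  obtain ⟨L, hL0, hL⟩ := eLpNorm_le_mul_of_le Ω (r := ENNReal.ofReal q) (s := ⊤)
    (by simpa using hq) le_top
  refine ⟨L * K, by positivity, fun φ hφ => ?_⟩
  refine (hL φ hφ.smooth.continuous.aestronglyMeasurable).trans ?_
  rw [ENNReal.ofReal_mul hL0, mul_assoc]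
  gcongr
  refine le_trans ?_ (hK _ hφ.continuous_gradient.aestronglyMeasurable)
  rw [eLpNorm_exponent_top]
  exact essSup_le_of_ae_le _ (ae_of_all _ (hsup φ hφ))

/-- The subcritical Sobolev inequality for test functions. -/
theorem exists_sobolev_test [NeZero N] (Ω : BoundedDomain N) (hp : 1 < p)
    (hq : 1 ≤ q) (hqp : (q : EReal) < criticalExponent N p) :
    ∃ K : ℝ, 0 ≤ K ∧ ∀ φ : Space N → ℝ, IsTestFunction Ω φ →
      eLpNorm φ (ENNReal.ofReal q) Ω.measure ≤
        ENNReal.ofReal K * eLpNorm (∇ φ) (ENNReal.ofReal p) Ω.measure := by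
  rcases (show N = 1 ∨ 2 ≤ N by have := NeZero.ne N; omega) with h | h
  · subst h
    exact exists_sobolev_test_one Ω hp hq
  · exact exists_sobolev_test_of_two_le Ω h hp hq hqp

end TestFunctions

/-! ### Control of the `L¹` norm by averages over small balls -/

section LocalAverages

variable {N : ℕ} {Ω : BoundedDomain N}

/-- The increment is an integral of the gradient over a segment; by Tonelli and translation
invariance every point of the segment contributes the same amount. -/
theorem IsTestFunction.lintegral_translate_sub_le {φ : Space N → ℝ} (hφ : IsTestFunction Ω φ)
    (h : Space N) :
    ∫⁻ x, ‖φ (x + h) - φ x‖ₑ ≤ ‖h‖ₑ * eLpNorm (∇ φ) 1 Ω.measure := by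
  have hc := hφ.continuous_gradient
  have hm : Measurable fun z : Space N × ℝ => ‖∇ φ (z.1 + z.2 • h)‖ₑ * ‖h‖ₑ :=
    (by fun_prop : Continuous fun z : Space N × ℝ =>
      ∇ φ (z.1 + z.2 • h)).measurable.enorm.mul_const _
  calc ∫⁻ x, ‖φ (x + h) - φ x‖ₑ
      ≤ ∫⁻ x, ∫⁻ t in Icc (0 : ℝ) 1, ‖∇ φ (x + t • h)‖ₑ * ‖h‖ₑ :=
        lintegral_mono fun x => by
          simpa using hφ.enorm_add_smul_sub_le x h zero_le_one
    _ = ∫⁻ t in Icc (0 : ℝ) 1, ∫⁻ x, ‖∇ φ (x + t • h)‖ₑ * ‖h‖ₑ :=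
        lintegral_lintegral_swap hm.aemeasurable
    _ = ∫⁻ _t in Icc (0 : ℝ) 1, ∫⁻ x, ‖∇ φ x‖ₑ * ‖h‖ₑ := by
        refine lintegral_congr fun t => ?_
        exact lintegral_add_right_eq_self (fun x => ‖∇ φ x‖ₑ * ‖h‖ₑ) (t • h)
    _ = ‖h‖ₑ * eLpNorm (∇ φ) 1 Ω.measure := by
        rw [lintegral_const, lintegral_mul_const _ hc.measurable.enorm,
          ← hφ.eLpNorm_gradient_univ, eLpNorm_one_eq_lintegral_enorm]
        simp [mul_comm]

theorem IsTestFunction.setIntegral_measure {φ : Space N → ℝ} (hφ : IsTestFunction Ω φ)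
    {A : Set (Space N)} (hA : MeasurableSet A) :
    ∫ y in A, φ y = ∫ y in A, φ y ∂Ω.measure := by
  rw [Measure.restrict_restrict hA]
  exact setIntegral_eq_of_subset_of_forall_sdiff_eq_zero hA inter_subset_left
    fun x hx => (gradient_support Ω hφ fun h => hx.2 ⟨hx.1, h⟩).1

/-- Write `φ x` as `φ y - (φ y - φ x)` and integrate over `y` in the ball about `z`, which lies in
the ball of radius `2ε` about `x`. -/
theorem IsTestFunction.volume_ball_mul_enorm_le {φ : Space N → ℝ} (hφ : IsTestFunction Ω φ)
    {ε : ℝ} {x z : Space N} (hxz : x ∈ Metric.ball z ε) :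
    volume (Metric.ball (0 : Space N) ε) * ‖φ x‖ₑ ≤
      ‖∫ y in Metric.ball z ε, φ y ∂Ω.measure‖ₑ +
        ∫⁻ h in Metric.ball (0 : Space N) (2 * ε), ‖φ (x + h) - φ x‖ₑ := by
  have hfin : volume (Metric.ball z ε) < ⊤ := measure_ball_lt_top
  have hint : IntegrableOn φ (Metric.ball z ε) :=
    (hφ.smooth.continuous.integrable_of_hasCompactSupport hφ.compact).integrableOn
  have hcst : IntegrableOn (fun _ => φ x) (Metric.ball z ε) := integrableOn_const hfin.ne
  have h1 : volume (Metric.ball (0 : Space N) ε) * ‖φ x‖ₑ =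
      ‖∫ _y in Metric.ball z ε, φ x‖ₑ := by
    rw [setIntegral_const, enorm_smul, Measure.real, Real.enorm_eq_ofReal ENNReal.toReal_nonneg,
      ENNReal.ofReal_toReal hfin.ne, ← Measure.addHaar_ball_center volume z]
  have h2 : ∫ _y in Metric.ball z ε, φ x =
      (∫ y in Metric.ball z ε, φ y) - ∫ y in Metric.ball z ε, (φ y - φ x) := by
    rw [integral_sub hint hcst, sub_sub_cancel]
  rw [h1, h2, hφ.setIntegral_measure measurableSet_ball]
  refine enorm_sub_le.trans (add_le_add le_rfl ((enorm_integral_le_lintegral_enorm _).trans ?_))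
  have h3 : Metric.ball z ε ⊆ Metric.ball x (2 * ε) :=
    Metric.ball_subset_ball' (by rw [dist_comm]; have := Metric.mem_ball.1 hxz; linarith)
  refine (lintegral_mono_set h3).trans_eq ?_
  rw [← lintegral_indicator measurableSet_ball, ← lintegral_indicator measurableSet_ball,
    ← lintegral_add_left_eq_self _ x]
  refine lintegral_congr fun h => ?_
  simp [indicator, Metric.mem_ball]

/-- Up to an error of order `ε`, the `L¹` norm of a test function is controlled by finitely many
averages over balls of radius `ε`. -/
theorem exists_finset_test (Ω : BoundedDomain N) {ε : ℝ} (hε : 0 < ε) :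
    ∃ S : Finset (Space N), ∀ φ : Space N → ℝ, IsTestFunction Ω φ →
      volume (Metric.ball (0 : Space N) ε) * eLpNorm φ 1 Ω.measure ≤
        Ω.measure univ * ∑ z ∈ S, ‖∫ y in Metric.ball z ε, φ y ∂Ω.measure‖ₑ +
        volume (Metric.ball (0 : Space N) (2 * ε)) * (ENNReal.ofReal (2 * ε) *
          eLpNorm (∇ φ) 1 Ω.measure) := by
  -- The centres form a finite `ε`-net of `Ω`, so each `x` in `Ω` can use the average over a ball
  -- that contains it.
  obtain ⟨t, ht, hcov⟩ := Metric.totallyBounded_iff.1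
    (Ω.isBounded.isCompact_closure.totallyBounded.subset subset_closure) ε hε
  refine ⟨ht.toFinset, fun φ hφ => ?_⟩
  set a : ℝ≥0∞ := ∑ z ∈ ht.toFinset, ‖∫ y in Metric.ball z ε, φ y ∂Ω.measure‖ₑ with ha
  have hφc := hφ.smooth.continuous
  have hm : Measurable fun z : Space N × Space N => ‖φ (z.1 + z.2) - φ z.1‖ₑ :=
    (by fun_prop : Continuous fun z : Space N × Space N =>
      φ (z.1 + z.2) - φ z.1).measurable.enorm
  rw [eLpNorm_one_eq_lintegral_enorm, ← lintegral_const_mul _ hφc.measurable.enorm]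
  calc ∫⁻ x in Ω.carrier, volume (Metric.ball (0 : Space N) ε) * ‖φ x‖ₑ
      ≤ ∫⁻ x in Ω.carrier, (a +
          ∫⁻ h in Metric.ball (0 : Space N) (2 * ε), ‖φ (x + h) - φ x‖ₑ) := by
        refine setLIntegral_mono' Ω.isOpen.measurableSet fun x hx => ?_
        obtain ⟨z, hz, hxz⟩ := mem_iUnion₂.1 (hcov hx)
        refine (hφ.volume_ball_mul_enorm_le hxz).trans (add_le_add ?_ le_rfl)
        exact Finset.single_le_sum
          (f := fun z => ‖∫ y in Metric.ball z ε, φ y ∂Ω.measure‖ₑ)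
          (fun _ _ => zero_le) (ht.mem_toFinset.2 hz)
    _ = Ω.measure univ * a + ∫⁻ x in Ω.carrier,
          ∫⁻ h in Metric.ball (0 : Space N) (2 * ε), ‖φ (x + h) - φ x‖ₑ := by
        rw [lintegral_add_left measurable_const, lintegral_const, mul_comm]
    _ ≤ Ω.measure univ * a + ∫⁻ x,
          ∫⁻ h in Metric.ball (0 : Space N) (2 * ε), ‖φ (x + h) - φ x‖ₑ := by
        exact add_le_add le_rfl (setLIntegral_le_lintegral _ _)
    _ = Ω.measure univ * a +
          ∫⁻ h in Metric.ball (0 : Space N) (2 * ε), ∫⁻ x, ‖φ (x + h) - φ x‖ₑ := by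
        rw [lintegral_lintegral_swap hm.aemeasurable]
    _ ≤ _ := by
        refine add_le_add le_rfl ?_
        refine (setLIntegral_mono' (g := fun _ => ENNReal.ofReal (2 * ε) *
          eLpNorm (∇ φ) 1 Ω.measure) measurableSet_ball fun h hh => ?_).trans_eq ?_
        · refine (hφ.lintegral_translate_sub_le h).trans ?_
          gcongr
          rw [← ofReal_norm]
          exact ENNReal.ofReal_le_ofReal (mem_ball_zero_iff.1 hh).le
        · rw [setLIntegral_const, mul_comm]

end LocalAverages

/-! ### Embeddings, compactness and completeness of `W_0^{1,p}(Ω)` -/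

section SobolevSpace

variable {N : ℕ} {Ω : BoundedDomain N} {p q : ℝ} [hp : Fact (1 < p)]

/-- Bounds of Lebesgue norms pass from test functions to `W_0^{1,p}(Ω)`. -/
theorem W0.eLpNorm_le_of_test {G : LpOn Ω p ℝ × LpOn Ω p (Space N) → ℝ≥0∞} (hG : Continuous G)
    {r : ℝ≥0∞} (h : ∀ w ∈ testPairs Ω p, eLpNorm w.1 r Ω.measure ≤ G w) (u : W0 Ω p) :
    eLpNorm u r Ω.measure ≤ G u.1 := by
  obtain ⟨w, hw, hlim⟩ := mem_closure_iff_seq_limit.1 u.2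
  have h1 : Tendsto (fun n => (w n).1) atTop (𝓝 u.toLp) :=
    (continuous_fst.tendsto _).comp hlim
  -- Convergence in `L^p` says nothing about `L^r` norms for large `r`; an almost everywhere
  -- convergent subsequence and Fatou's lemma give the lower semicontinuity.
  obtain ⟨σ, hσ, hae⟩ := (tendstoInMeasure_of_tendsto_Lp h1).exists_seq_tendsto_ae
  have h2 := Lp.eLpNorm_lim_le_liminf_eLpNorm (p := r)
    (fun n => Lp.aestronglyMeasurable (w (σ n)).1) _ hae
  refine h2.trans ((liminf_le_liminf (Eventually.of_forall fun n => h _ (hw (σ n)))).trans_eq ?_)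
  exact ((hG.tendsto _).comp (hlim.comp hσ.tendsto_atTop)).liminf_eq

theorem W0.aestronglyMeasurable (u : W0 Ω p) : AEStronglyMeasurable u Ω.measure :=
  Lp.aestronglyMeasurable u.toLp

theorem W0.coeFn_add (u v : W0 Ω p) : (u + v : W0 Ω p) =ᵐ[Ω.measure] fun x => u x + v x :=
  Lp.coeFn_add u.toLp v.toLp

theorem W0.coeFn_sub (u v : W0 Ω p) : (u - v : W0 Ω p) =ᵐ[Ω.measure] fun x => u x - v x :=
  Lp.coeFn_sub u.toLp v.toLp

theorem W0.coeFn_smul (c : ℝ) (u : W0 Ω p) : (c • u : W0 Ω p) =ᵐ[Ω.measure] fun x => c * u x :=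
  Lp.coeFn_smul c u.toLp

theorem enorm_eq_eLpNorm {E : Type} [NormedAddCommGroup E] (w : LpOn Ω p E) :
    ‖w‖ₑ = eLpNorm w (ENNReal.ofReal p) Ω.measure := by
  rw [← ofReal_norm, Lp.norm_def, ENNReal.ofReal_toReal (Lp.eLpNorm_ne_top w)]

/-- The subcritical Sobolev embedding. -/
theorem W0.exists_sobolev [NeZero N] (Ω : BoundedDomain N) (p : ℝ) [hp : Fact (1 < p)]
    (hq : 1 ≤ q) (hqp : (q : EReal) < criticalExponent N p) :
    ∃ K : ℝ, 0 ≤ K ∧ ∀ u : W0 Ω p,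
      eLpNorm u (ENNReal.ofReal q) Ω.measure ≤ ENNReal.ofReal (K * ‖u‖) := by
  obtain ⟨K, hK0, hK⟩ := exists_sobolev_test Ω hp.out hq hqp
  refine ⟨K, hK0, fun u => ?_⟩
  rw [ENNReal.ofReal_mul hK0, ofReal_norm]
  refine W0.eLpNorm_le_of_test (G := fun w => ENNReal.ofReal K * ‖w.2‖ₑ) ?_ ?_ u
  · exact (ENNReal.continuous_const_mul ENNReal.ofReal_ne_top).comp
      (continuous_enorm.comp continuous_snd)
  · rintro w ⟨φ, hφ, h1, h2⟩
    rw [enorm_eq_eLpNorm, eLpNorm_congr_ae h1, eLpNorm_congr_ae h2]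
    exact hK φ hφ

theorem continuous_setIntegral_of_Lp (A : Set (Space N)) :
    Continuous fun w : LpOn Ω p ℝ => ∫ x in A, w x ∂Ω.measure := by
  obtain ⟨K, hK0, hK⟩ := eLpNorm_le_mul_of_le Ω (r := 1) (s := ENNReal.ofReal p) le_rfl
    (by simpa using hp.out.le)
  have hint (w : LpOn Ω p ℝ) : Integrable w Ω.measure :=
    (Lp.memLp w).integrable (by simpa using hp.out.le)
  refine continuous_iff_seqContinuous.2 fun w v hw => ?_
  refine tendsto_setIntegral_of_L1' _ (hint v).aestronglyMeasurable (Eventually.of_forall fun n => hint _) ?_ A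
  have h1 := (Lp.tendsto_Lp_iff_tendsto_eLpNorm' _ _).1 hw
  have h2 := ENNReal.Tendsto.const_mul h1 (Or.inr (ENNReal.ofReal_ne_top (r := K)))
  rw [mul_zero] at h2
  exact tendsto_of_tendsto_of_tendsto_of_le_of_le tendsto_const_nhds h2 (fun _ => zero_le)
    fun n => hK _ ((Lp.aestronglyMeasurable _).sub (Lp.aestronglyMeasurable _))

/-- It matters that `C` is fixed before `ε`: the averages are then made small with `ε` frozen, while
the remainder is small on bounded sets. -/
theorem W0.exists_finset (Ω : BoundedDomain N) (p : ℝ) [hp : Fact (1 < p)] [NeZero N] :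
    ∃ C : ℝ, 0 ≤ C ∧ ∀ ε : ℝ, 0 < ε → ∃ (S : Finset (Space N)) (A : ℝ), 0 ≤ A ∧
      ∀ u : W0 Ω p, eLpNorm u 1 Ω.measure ≤
        ENNReal.ofReal (A * ∑ z ∈ S, |∫ y in Metric.ball z ε, u y ∂Ω.measure| +
          C * ε * ‖u‖) := by
  obtain ⟨K, hK0, hK⟩ := eLpNorm_le_mul_of_le Ω (r := 1) (s := ENNReal.ofReal p) le_rfl
    (by simpa using hp.out.le)
  -- `2 ^ N` is the ratio of the volumes of the balls of radii `2ε` and `ε`, the factor `2` comes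
  -- from translations of length up to `2ε`, and `K` passes from `L¹` to `L^p`.
  refine ⟨2 ^ N * 2 * K, by positivity, fun ε hε => ?_⟩
  obtain ⟨S, hS⟩ := exists_finset_test Ω hε
  set V : ℝ≥0∞ := volume (Metric.ball (0 : Space N) ε) with hV
  have hV0 : V ≠ 0 := (Metric.measure_ball_pos _ _ hε).ne'
  have hVt : V ≠ ⊤ := measure_ball_lt_top.ne
  have hV2 : volume (Metric.ball (0 : Space N) (2 * ε)) = ENNReal.ofReal (2 ^ N) * V := by
    rw [Measure.addHaar_ball_mul _ _ (by norm_num)]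
    simp [hV]
  refine ⟨S, (V⁻¹ * Ω.measure univ).toReal, ENNReal.toReal_nonneg, fun u => ?_⟩
  have hA : ENNReal.ofReal (V⁻¹ * Ω.measure univ).toReal = V⁻¹ * Ω.measure univ :=
    ENNReal.ofReal_toReal (ENNReal.mul_ne_top (ENNReal.inv_ne_top.2 hV0) (measure_ne_top _ _))
  rw [ENNReal.ofReal_add (by positivity) (by positivity), ENNReal.ofReal_mul (by positivity),
    ENNReal.ofReal_mul (by positivity), ENNReal.ofReal_sum_of_nonneg (fun _ _ => abs_nonneg _), hA,
    ofReal_norm]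
  simp only [← Real.enorm_eq_ofReal_abs]
  refine W0.eLpNorm_le_of_test (G := fun w => V⁻¹ * Ω.measure univ *
    ∑ z ∈ S, ‖∫ y in Metric.ball z ε, w.1 y ∂Ω.measure‖ₑ +
    ENNReal.ofReal (2 ^ N * 2 * K * ε) * ‖w.2‖ₑ) ?_ ?_ u
  · refine Continuous.add ?_ ?_
    · refine (ENNReal.continuous_const_mul (by rw [← hA]; exact ENNReal.ofReal_ne_top)).comp ?_
      refine continuous_finsetSum _ fun z _ => continuous_enorm.comp ?_
      exact (continuous_setIntegral_of_Lp _).comp continuous_fst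
    · exact (ENNReal.continuous_const_mul ENNReal.ofReal_ne_top).comp
        (continuous_enorm.comp continuous_snd)
  · rintro w ⟨φ, hφ, h1, h2⟩
    rw [enorm_eq_eLpNorm, eLpNorm_congr_ae h1, eLpNorm_congr_ae h2]
    have h3 : ∀ z, ∫ y in Metric.ball z ε, w.1 y ∂Ω.measure =
        ∫ y in Metric.ball z ε, φ y ∂Ω.measure :=
      fun z => integral_congr_ae (ae_restrict_of_ae h1)
    simp only [h3]
    have h4 := hS φ hφ
    rw [hV2] at h4
    have h5 : eLpNorm φ 1 Ω.measure = V⁻¹ * (V * eLpNorm φ 1 Ω.measure) := by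
      rw [← mul_assoc, ENNReal.inv_mul_cancel hV0 hVt, one_mul]
    rw [h5]
    refine (mul_le_mul_right h4 V⁻¹).trans ?_
    rw [mul_add, ← mul_assoc]
    refine add_le_add le_rfl ?_
    have h6 : V⁻¹ * (ENNReal.ofReal (2 ^ N) * V * (ENNReal.ofReal (2 * ε) *
        eLpNorm (∇ φ) 1 Ω.measure)) = ENNReal.ofReal (2 ^ N) * ENNReal.ofReal (2 * ε) *
          eLpNorm (∇ φ) 1 Ω.measure := by
      calc _ = (V⁻¹ * V) * (ENNReal.ofReal (2 ^ N) * ENNReal.ofReal (2 * ε) *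
          eLpNorm (∇ φ) 1 Ω.measure) := by ring
        _ = _ := by rw [ENNReal.inv_mul_cancel hV0 hVt, one_mul]
    rw [h6, ← ENNReal.ofReal_mul (by positivity),
      show (2 : ℝ) ^ N * 2 * K * ε = 2 ^ N * (2 * ε) * K by ring,
      ENNReal.ofReal_mul (p := 2 ^ N * (2 * ε)) (by positivity), mul_assoc]
    gcongr
    exact hK _ hφ.continuous_gradient.aestronglyMeasurable

/-- The compactness of the embedding of `W_0^{1,p}(Ω)` into `L¹(Ω)`. -/
theorem W0.exists_subseq_cauchy [NeZero N] (u : ℕ → W0 Ω p) {B : ℝ} (hB : ∀ n, ‖u n‖ ≤ B) :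
    ∃ σ : ℕ → ℕ, StrictMono σ ∧ ∀ ε : ℝ, 0 < ε → ∃ n₀, ∀ m ≥ n₀, ∀ n ≥ n₀,
      eLpNorm (u (σ m) - u (σ n) : W0 Ω p) 1 Ω.measure ≤ ENNReal.ofReal ε := by
  have hB0 : 0 ≤ B := (norm_nonneg _).trans (hB 0)
  obtain ⟨R, hR0, hR⟩ := W0.exists_poincare Ω p
  obtain ⟨K, hK0, hK⟩ := eLpNorm_le_mul_of_le Ω (r := 1) (s := ENNReal.ofReal p) le_rfl
    (by simpa using hp.out.le)
  have hint (u : W0 Ω p) : Integrable u Ω.measure :=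
    (Lp.memLp u.toLp).integrable (by simpa using hp.out.le)
  have hbd (A : Set (Space N)) (n : ℕ) : |∫ y in A, u n y ∂Ω.measure| ≤ K * (R * B) := by
    have h1 : eLpNorm (u n) 1 Ω.measure ≤ ENNReal.ofReal (K * (R * B)) := by
      refine (hK _ (u n).aestronglyMeasurable).trans ?_
      rw [ENNReal.ofReal_mul hK0]
      gcongr
      refine (enorm_eq_eLpNorm (u n).toLp).symm.trans_le ?_
      rw [← ofReal_norm]
      exact ENNReal.ofReal_le_ofReal ((hR _).trans (by gcongr; exact hB n))
    rw [← ENNReal.ofReal_le_ofReal_iff (by positivity), ← Real.enorm_eq_ofReal_abs]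
    refine le_trans ?_ h1
    rw [eLpNorm_one_eq_lintegral_enorm]
    exact (enorm_integral_le_lintegral_enorm _).trans (setLIntegral_le_lintegral _ _)
  obtain ⟨C, hC0, hC⟩ := W0.exists_finset Ω p
  choose S A hA0 hSA using fun k : ℕ => hC (1 / (k + 1 : ℝ)) (by positivity)
  -- All averages over all the nets, radius `1/(k+1)` at level `k`, form one point of a countable
  -- product of compact intervals. Compactness of the product replaces a diagonal extraction.
  let X : ℕ → ((i : Σ k : ℕ, {z // z ∈ S k}) → ℝ) := fun n i =>
    ∫ y in Metric.ball (i.2 : Space N) (1 / (i.1 + 1 : ℝ)), u n y ∂Ω.measure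
  have hX : ∀ n, X n ∈ Set.pi univ
      fun _ : Σ k : ℕ, {z // z ∈ S k} => Icc (-(K * (R * B))) (K * (R * B)) :=
    fun n i _ => abs_le.1 (hbd _ n)
  obtain ⟨Y, -, σ, hσ, hlim⟩ := (isCompact_univ_pi fun _ => isCompact_Icc).tendsto_subseq hX
  refine ⟨σ, hσ, fun ε hε => ?_⟩
  obtain ⟨k, hk⟩ := exists_nat_gt (C * (2 * B) * 2 / ε)
  have hk' : C * (1 / (k + 1 : ℝ)) * (2 * B) ≤ ε / 2 := by
    rw [div_lt_iff₀ hε] at hk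
    have : C * (1 / (k + 1 : ℝ)) * (2 * B) = C * (2 * B) / (k + 1) := by ring
    rw [this, div_le_iff₀ (by positivity)]
    nlinarith
  have hcau : Tendsto (fun mn : ℕ × ℕ => A k * ∑ z ∈ (S k).attach,
      |X (σ mn.1) ⟨k, z⟩ - X (σ mn.2) ⟨k, z⟩|) atTop (𝓝 0) := by
    have hz (z : {z // z ∈ S k}) : Tendsto (fun mn : ℕ × ℕ =>
        |X (σ mn.1) ⟨k, z⟩ - X (σ mn.2) ⟨k, z⟩|) atTop (𝓝 0) := by
      have h1 := (tendsto_pi_nhds.1 hlim ⟨k, z⟩)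
      have h2 := (h1.comp (tendsto_fst (f := atTop) (g := atTop))).sub
        (h1.comp (tendsto_snd (f := atTop) (g := atTop)))
      rw [prod_atTop_atTop_eq, sub_self] at h2
      simpa using h2.abs
    simpa using (tendsto_finsetSum (S k).attach fun z _ => hz z).const_mul (A k)
  obtain ⟨⟨n₁, n₂⟩, hn⟩ := eventually_atTop.1 (hcau.eventually_lt_const (half_pos hε))
  refine ⟨max n₁ n₂, fun m hm n hn' => ?_⟩
  refine (hSA k _).trans (ENNReal.ofReal_le_ofReal ?_)
  have h1 := hn (m, n) ⟨(le_max_left _ _).trans hm, (le_max_right _ _).trans hn'⟩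
  have h2 : ∑ z ∈ S k, |∫ y in Metric.ball z (1 / (k + 1 : ℝ)),
      (u (σ m) - u (σ n) : W0 Ω p) y ∂Ω.measure| = ∑ z ∈ (S k).attach,
      |X (σ m) ⟨k, z⟩ - X (σ n) ⟨k, z⟩| := by
    rw [← Finset.sum_attach]
    refine Finset.sum_congr rfl fun z _ => ?_
    congr 1
    rw [← integral_sub (hint _).integrableOn (hint _).integrableOn]
    exact integral_congr_ae (ae_restrict_of_ae (W0.coeFn_sub _ _))
  have h3 : ‖u (σ m) - u (σ n)‖ ≤ 2 * B := by
    refine (norm_sub_le _ _).trans ?_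
    linarith [hB (σ m), hB (σ n)]
  rw [h2]
  have h4 : C * (1 / (k + 1 : ℝ)) * ‖u (σ m) - u (σ n)‖ ≤ ε / 2 :=
    le_trans (by gcongr) hk'
  linarith

/-- By Poincaré's inequality a Cauchy sequence for the gradient norm is Cauchy in the product of the
Lebesgue spaces, where the space is closed. -/
instance W0.completeSpace [NeZero N] : CompleteSpace (W0 Ω p) := by
  obtain ⟨R, hR0, hR⟩ := W0.exists_poincare Ω p
  refine Metric.complete_of_cauchySeq_tendsto fun u hu => ?_
  let L : W0 Ω p →L[ℝ] LpOn Ω p ℝ × LpOn Ω p (Space N) :=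
    LinearMap.mkContinuous ((testPairs Ω p).topologicalClosure.subtype) (max R 1) fun u => by
      rw [max_mul_of_nonneg _ _ (norm_nonneg _), one_mul]
      exact max_le_max (hR u) le_rfl
  obtain ⟨w, hw⟩ := cauchySeq_tendsto_of_complete (L.uniformContinuous.comp_cauchySeq hu)
  have hmem : w ∈ (testPairs Ω p).topologicalClosure :=
    (Submodule.isClosed_topologicalClosure _).mem_of_tendsto hw
      (Eventually.of_forall fun n => (u n).2)
  let v : W0 Ω p := ⟨w, hmem⟩
  refine ⟨v, tendsto_iff_norm_sub_tendsto_zero.2 ?_⟩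
  have h : Tendsto (fun n => W0.grad Ω p (u n)) atTop (𝓝 w.2) :=
    (continuous_snd.tendsto w).comp hw
  have h0 := tendsto_iff_norm_sub_tendsto_zero.1 h
  exact h0

end SobolevSpace

/-! ### Carathéodory functions and the derivative of the integral term -/

section Nemytskii

variable {N : ℕ} {Ω : BoundedDomain N} {f : Space N → ℝ → ℝ} {p ϖ : ℝ}

/-- A Carathéodory function agrees, for almost every `x`, with one that is measurable in `x` and
continuous in `v` without exception. -/
theorem IsCaratheodory.exists_version (hf : IsCaratheodory Ω f) :
    ∃ g : ℝ → Space N → ℝ, (∀ x, Continuous fun v => g v x) ∧ (∀ v, Measurable (g v)) ∧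
      ∀ᵐ x ∂Ω.measure, ∀ v, f x v = g v x := by
  classical
  -- Only rational `v` are used here, so that countably many null sets are discarded; continuity
  -- recovers the other values of `v`.
  have hae : ∀ᵐ x ∂Ω.measure, Continuous (f x) ∧
      ∀ r : ℚ, f x r = (hf.measurable r).mk (fun x => f x r) x :=
    hf.continuous.and (ae_all_iff.2 fun r => (hf.measurable r).ae_eq_mk)
  obtain ⟨t, ht, htm, ht0⟩ := exists_measurable_superset_of_null (ae_iff.1 hae)
  have hgood : ∀ x, x ∉ t → Continuous (f x) ∧
      ∀ r : ℚ, f x r = (hf.measurable r).mk (fun x => f x r) x := fun x hx => by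
    by_contra h
    exact hx (ht h)
  let g : ℝ → Space N → ℝ := fun v x => if x ∈ t then 0 else f x v
  have hgc : ∀ x, Continuous fun v => g v x := fun x => by
    by_cases hx : x ∈ t
    · simpa [g, hx] using continuous_const
    · simpa [g, hx] using (hgood x hx).1
  have hgq : ∀ r : ℚ, Measurable (g r) := fun r => by
    have : g r = fun x => if x ∈ t then 0 else (hf.measurable r).mk (fun x => f x r) x := by
      funext x
      by_cases hx : x ∈ t
      · simp [g, hx]
      · simp [g, hx, (hgood x hx).2 r]
    rw [this]
    exact Measurable.ite htm measurable_const (hf.measurable r).measurable_mk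
  refine ⟨g, hgc, fun v => ?_, ?_⟩
  · obtain ⟨s, hs, hlim⟩ := mem_closure_iff_seq_limit.1
      (Rat.denseRange_cast (𝕜 := ℝ) v)
    refine measurable_of_tendsto_metrizable (f := fun n => g (s n)) (fun n => ?_) ?_
    · obtain ⟨r, hr⟩ := hs n
      rw [← hr]
      exact hgq r
    · exact tendsto_pi_nhds.2 fun x => ((hgc x).tendsto v).comp hlim
  · have : ∀ᵐ x ∂Ω.measure, x ∉ t := measure_eq_zero_iff_ae_notMem.1 ht0
    filter_upwards [this] with x hx v
    simp [g, hx]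

theorem IsCaratheodory.aestronglyMeasurable_comp (hf : IsCaratheodory Ω f) {u : Space N → ℝ}
    (hu : AEStronglyMeasurable u Ω.measure) :
    AEStronglyMeasurable (fun x => f x (u x)) Ω.measure := by
  obtain ⟨g, hgc, hgm, hg⟩ := hf.exists_version
  have h := (measurable_uncurry_of_continuous_of_measurable hgc hgm).comp
    (hu.stronglyMeasurable_mk.measurable.prodMk measurable_id)
  refine ⟨_, h.stronglyMeasurable, ?_⟩
  filter_upwards [hg, hu.ae_eq_mk] with x hx hux
  simp [hx, ← hux]

theorem IsCaratheodory.aestronglyMeasurable_primitive (hf : IsCaratheodory Ω f) {u : Space N → ℝ}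
    (hu : AEStronglyMeasurable u Ω.measure) :
    AEStronglyMeasurable (fun x => primitive (f x) (u x)) Ω.measure := by
  obtain ⟨g, hgc, hgm, hg⟩ := hf.exists_version
  have hum : Measurable (hu.mk u) := hu.stronglyMeasurable_mk.measurable
  -- Rescaling `s = t u(x)` turns the integral over an interval depending on `x` into one over the
  -- fixed interval from `0` to `1`, to which Fubini measurability applies.
  have h1 : Measurable fun z : Space N × ℝ => g (z.2 * hu.mk u z.1) z.1 :=
    (measurable_uncurry_of_continuous_of_measurable hgc hgm).comp
      ((measurable_snd.mul (hum.comp measurable_fst)).prodMk measurable_fst)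
  have h2 : StronglyMeasurable fun x => ∫ s in Ioc (0 : ℝ) 1, g (s * hu.mk u x) x :=
    h1.stronglyMeasurable.integral_prod_right
  refine ⟨_, hum.stronglyMeasurable.mul h2, ?_⟩
  filter_upwards [hg, hu.ae_eq_mk] with x hx hux
  have h3 : primitive (f x) (u x) = ∫ s in (0 : ℝ)..(u x), g s x := by
    simp only [primitive, hx]
  rw [h3, Pi.mul_apply, ← intervalIntegral.integral_of_le zero_le_one, ← hux]
  have h4 := intervalIntegral.smul_integral_comp_mul_right (a := 0) (b := 1) (fun s => g s x) (u x)
  rw [zero_mul, one_mul, smul_eq_mul] at h4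
  exact h4.symm

/-- Splitting a product according to whether `a ≤ T`. -/
theorem rpow_sub_one_mul_le {a d T q : ℝ} (ha : 0 ≤ a) (hd : 0 ≤ d) (hT : 0 < T) (hϖ : 1 < ϖ)
    (hq : ϖ ≤ q) : a ^ (ϖ - 1) * d ≤ T ^ (ϖ - 1) * d + T ^ (ϖ - q) * (a ^ q + d ^ q) := by
  have hn : 0 ≤ T ^ (ϖ - q) * (a ^ q + d ^ q) := by positivity
  rcases le_or_gt a T with h | h
  · have : a ^ (ϖ - 1) * d ≤ T ^ (ϖ - 1) * d := by gcongr
    linarith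
  -- For `a > T`, the product is at most `b ^ ϖ = b ^ (ϖ - q) * b ^ q`, and the first factor
  -- decreases in `b ≥ T`.
  · set b := max a d with hb
    have hab : a ≤ b := le_max_left _ _
    have hTb : T ≤ b := h.le.trans hab
    have hb0 : 0 < b := hT.trans_le hTb
    have h1 : a ^ (ϖ - 1) * d ≤ b ^ (ϖ - 1) * b :=
      mul_le_mul (Real.rpow_le_rpow ha hab (by linarith)) (le_max_right _ _) hd (by positivity)
    have h2 : b ^ (ϖ - 1) * b = b ^ (ϖ - q) * b ^ q := by
      rw [← Real.rpow_add_one hb0.ne', ← Real.rpow_add hb0]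
      congr 1
      ring
    have h3 : b ^ (ϖ - q) ≤ T ^ (ϖ - q) :=
      Real.rpow_le_rpow_of_nonpos hT hTb (by linarith)
    have h4 : b ^ q ≤ a ^ q + d ^ q := by
      rcases max_choice a d with h | h <;> rw [hb, h] <;>
        linarith [Real.rpow_nonneg ha q, Real.rpow_nonneg hd q]
    have h5 : 0 ≤ T ^ (ϖ - 1) * d := by positivity
    have h6 : b ^ (ϖ - q) * b ^ q ≤ T ^ (ϖ - q) * (a ^ q + d ^ q) := by gcongr
    linarith

theorem one_add_rpow_sub_one_mul_le {a d : ℝ} (ha : 0 ≤ a) (hd : 0 ≤ d) (hϖ : 1 < ϖ) :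
    (1 + a ^ (ϖ - 1)) * d ≤ 3 * (1 + a ^ ϖ + d ^ ϖ) := by
  have h1 := rpow_sub_one_mul_le ha hd one_pos hϖ le_rfl
  have h2 : d ≤ 1 + d ^ ϖ := by
    rcases le_or_gt d 1 with h | h
    · linarith [Real.rpow_nonneg hd ϖ]
    · have := Real.self_le_rpow_of_one_le h.le hϖ.le
      linarith
  simp only [Real.one_rpow, one_mul] at h1
  linarith [Real.rpow_nonneg ha ϖ, Real.rpow_nonneg hd ϖ]

theorem abs_primitive_le {g : ℝ → ℝ} {C₀ : ℝ} (hC : 0 < C₀) (hϖ : 1 < ϖ)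
    (hg : ∀ v, |g v| ≤ C₀ * (1 + |v| ^ (ϖ - 1))) (v : ℝ) :
    |primitive g v| ≤ C₀ * (6 * (1 + |v| ^ ϖ)) := by
  have h := intervalIntegral.norm_integral_le_of_norm_le_const (a := 0) (b := v) (f := g)
    (C := C₀ * (1 + |v| ^ (ϖ - 1))) fun s hs => by
      refine (hg s).trans ?_
      have : |s| ≤ |v| := by
        rcases le_total 0 v with h | h
        · rw [uIoc_of_le h] at hs
          rw [abs_of_pos hs.1, abs_of_nonneg h]
          exact hs.2
        · rw [uIoc_of_ge h] at hs
          rw [abs_of_nonpos hs.2, abs_of_nonpos h]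
          linarith [hs.1]
      gcongr
  rw [sub_zero, mul_assoc] at h
  refine h.trans (mul_le_mul_of_nonneg_left ?_ hC.le)
  refine (one_add_rpow_sub_one_mul_le (abs_nonneg v) (abs_nonneg v) hϖ).trans ?_
  linarith [Real.rpow_nonneg (abs_nonneg v) ϖ]

theorem hasDerivAt_primitive_of_continuous {g : ℝ → ℝ} (hg : Continuous g) (v : ℝ) :
    HasDerivAt (primitive g) (g v) v :=
  intervalIntegral.integral_hasDerivAt_right (hg.intervalIntegrable _ _)
    hg.stronglyMeasurable.stronglyMeasurableAtFilter hg.continuousAt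

theorem integrable_abs_rpow_of_memLp {u : Space N → ℝ} {r : ℝ} (hr : 0 < r)
    (hu : MemLp u (ENNReal.ofReal r) Ω.measure) :
    Integrable (fun x => |u x| ^ r) Ω.measure := by
  have h := hu.integrable_norm_rpow (by simpa using hr) ENNReal.ofReal_ne_top
  rw [ENNReal.toReal_ofReal hr.le] at h
  exact h

theorem SubcriticalGrowth.ae_abs_primitive_le (hf : SubcriticalGrowth Ω p f ϖ) :
    ∃ C : ℝ, 0 < C ∧ ∀ x ∈ Ω.carrier, ∀ v : ℝ, |primitive (f x) v| ≤ C * (1 + |v| ^ ϖ) := by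
  obtain ⟨C₀, hC, hg⟩ := hf.growth
  refine ⟨C₀ * 6, by positivity, fun x hx v => ?_⟩
  rw [mul_assoc]
  exact abs_primitive_le hC hf.one_lt (hg x hx) v

theorem SubcriticalGrowth.integrable_primitive (hf : SubcriticalGrowth Ω p f ϖ) {u : Space N → ℝ}
    (hu : MemLp u (ENNReal.ofReal ϖ) Ω.measure) :
    Integrable (fun x => primitive (f x) (u x)) Ω.measure := by
  obtain ⟨C, hC, hg⟩ := hf.ae_abs_primitive_le
  have hϖ := hf.one_lt
  refine Integrable.mono' (((integrable_const 1).add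
    (integrable_abs_rpow_of_memLp (by linarith) hu)).const_mul C)
    (hf.caratheodory.aestronglyMeasurable_primitive hu.1) ?_
  filter_upwards [ae_restrict_mem Ω.isOpen.measurableSet] with x hx
  exact hg x hx (u x)

/-- The Gateaux derivative of `u ↦ ∫_Ω F(x,u)`. -/
theorem SubcriticalGrowth.hasDerivAt_integral_primitive (hf : SubcriticalGrowth Ω p f ϖ)
    {u v : Space N → ℝ} (hu : MemLp u (ENNReal.ofReal ϖ) Ω.measure)
    (hv : MemLp v (ENNReal.ofReal ϖ) Ω.measure) :
    Integrable (fun x => f x (u x) * v x) Ω.measure ∧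
    HasDerivAt (fun t : ℝ => ∫ x in Ω.carrier, primitive (f x) (u x + t * v x))
      (∫ x in Ω.carrier, f x (u x) * v x) 0 := by
  obtain ⟨C₀, hC, hg⟩ := hf.growth
  have hϖ := hf.one_lt
  -- For `|t| < 1`, `|u| + |v|` dominates `|u + t v|`; this gives a bound of the derivative uniform
  -- in `t`.
  have hsum : MemLp (fun x => |u x| + |v x|) (ENNReal.ofReal ϖ) Ω.measure := hu.abs.add hv.abs
  have hb : Integrable (fun x => C₀ * (3 * (1 + |(|u x| + |v x|)| ^ ϖ + |v x| ^ ϖ))) Ω.measure :=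
    ((((integrable_const 1).add (integrable_abs_rpow_of_memLp (by linarith) hsum)).add
      (integrable_abs_rpow_of_memLp (by linarith) hv)).const_mul 3).const_mul C₀
  have hut (t : ℝ) : MemLp (fun x => u x + t * v x) (ENNReal.ofReal ϖ) Ω.measure :=
    hu.add (hv.const_mul t)
  have h := hasDerivAt_integral_of_dominated_loc_of_deriv_le (μ := Ω.measure) (x₀ := (0 : ℝ))
    (F := fun t x => primitive (f x) (u x + t * v x))
    (F' := fun t x => f x (u x + t * v x) * v x) (Metric.ball_mem_nhds 0 one_pos)
    (Eventually.of_forall fun t => hf.caratheodory.aestronglyMeasurable_primitive (hut t).1)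
    (hf.integrable_primitive (hut 0))
    ((hf.caratheodory.aestronglyMeasurable_comp (hut 0).1).mul hv.1) ?_ hb ?_
  · simpa using h
  · filter_upwards [ae_restrict_mem Ω.isOpen.measurableSet] with x hx t ht
    have ht1 : |t| ≤ 1 := by
      have := mem_ball_zero_iff.1 ht
      rw [Real.norm_eq_abs] at this
      exact this.le
    have h1 : |u x + t * v x| ≤ |u x| + |v x| := by
      refine (abs_add_le _ _).trans ?_
      rw [abs_mul]
      nlinarith [abs_nonneg (v x)]
    rw [norm_mul, Real.norm_eq_abs, Real.norm_eq_abs]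
    calc |f x (u x + t * v x)| * |v x|
        ≤ C₀ * (1 + |u x + t * v x| ^ (ϖ - 1)) * |v x| := by
          gcongr
          exact hg x hx _
      _ ≤ C₀ * (1 + |(|u x| + |v x|)| ^ (ϖ - 1)) * |v x| := by
          have h2 := Real.rpow_le_rpow (abs_nonneg _) (h1.trans (le_abs_self _))
            (show 0 ≤ ϖ - 1 by linarith)
          gcongr
      _ ≤ _ := by
          rw [mul_assoc]
          refine mul_le_mul_of_nonneg_left ?_ hC.le
          exact one_add_rpow_sub_one_mul_le (abs_nonneg _) (abs_nonneg _) hϖ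
  · filter_upwards [hf.caratheodory.continuous] with x hx t _
    have h1 : HasDerivAt (fun t : ℝ => u x + t * v x) (v x) t := by
      simpa using ((hasDerivAt_id t).mul_const (v x)).const_add (u x)
    exact (hasDerivAt_primitive_of_continuous hx _).comp t h1

end Nemytskii

/-! ### Uniform convexity of the `p`-th power of the norm -/

section UniformConvexity

variable {E : Type*} [NormedAddCommGroup E] [NormedSpace ℝ E]

theorem norm_midpoint_le (a b : E) : ‖(1 / 2 : ℝ) • (a + b)‖ ≤ 1 / 2 * ‖a‖ + 1 / 2 * ‖b‖ := by
  rw [norm_smul, ← mul_add]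
  norm_num
  exact norm_add_le a b

/-- If the norms agree, strictness comes from the strictly convex space; if they differ, from the
strict convexity of `s ↦ s ^ p`. -/
theorem norm_midpoint_rpow_lt [StrictConvexSpace ℝ E] {p : ℝ} (hp : 1 < p) {a b : E}
    (hab : a ≠ b) :
    ‖(1 / 2 : ℝ) • (a + b)‖ ^ p < (‖a‖ ^ p + ‖b‖ ^ p) / 2 := by
  have hp0 : 0 < p := by linarith
  by_cases h : ‖a‖ = ‖b‖
  · have h1 : ‖(1 / 2 : ℝ) • (a + b)‖ < ‖a‖ := by
      rw [smul_add]
      exact norm_combo_lt_of_ne le_rfl h.symm.le hab (by norm_num) (by norm_num) (by norm_num)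
    rw [← h]
    calc _ < ‖a‖ ^ p := Real.rpow_lt_rpow (norm_nonneg _) h1 hp0
      _ = _ := by ring
  · have h1 := (strictConvexOn_rpow hp).2 (norm_nonneg a) (norm_nonneg b) h
      (show (0 : ℝ) < 1 / 2 by norm_num) (show (0 : ℝ) < 1 / 2 by norm_num) (by norm_num)
    simp only [smul_eq_mul] at h1
    calc _ ≤ (1 / 2 * ‖a‖ + 1 / 2 * ‖b‖) ^ p :=
          Real.rpow_le_rpow (norm_nonneg _) (norm_midpoint_le a b) hp0.le
      _ < _ := h1
      _ = _ := by ring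

/-- A quantitative form of the uniform convexity of `‖·‖ ^ p`. -/
theorem exists_uniform_convexity [FiniteDimensional ℝ E] [StrictConvexSpace ℝ E] {p : ℝ}
    (hp : 1 < p) {ε : ℝ} (hε : 0 < ε) :
    ∃ C : ℝ, 0 ≤ C ∧ ∀ a b : E, ‖a - b‖ ^ p ≤ ε * (‖a‖ ^ p + ‖b‖ ^ p) +
      C * ((‖a‖ ^ p + ‖b‖ ^ p) / 2 - ‖(1 / 2 : ℝ) • (a + b)‖ ^ p) := by
  have hp0 : 0 < p := by linarith
  have hrp : Continuous fun s : ℝ => s ^ p := Real.continuous_rpow_const hp0.le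
  have hnn (a b : E) : 0 ≤ (‖a‖ ^ p + ‖b‖ ^ p) / 2 - ‖(1 / 2 : ℝ) • (a + b)‖ ^ p := by
    by_cases hab : a = b
    · subst hab
      rw [← two_smul ℝ a, smul_smul]
      norm_num
    · exact (sub_pos.2 (norm_midpoint_rpow_lt hp hab)).le
  have c1 : Continuous fun z : E × E => ‖z.1‖ ^ p + ‖z.2‖ ^ p := by fun_prop
  have c2 : Continuous fun z : E × E => ‖z.1 - z.2‖ ^ p := by fun_prop
  have c3 : Continuous fun z : E × E =>
    (‖z.1‖ ^ p + ‖z.2‖ ^ p) / 2 - ‖(1 / 2 : ℝ) • (z.1 + z.2)‖ ^ p := by fun_prop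
  -- On the normalised pairs that are not `ε`-close, the convexity gap has a positive minimum by
  -- compactness. The constant is the maximum of `‖a - b‖ ^ p` there divided by that minimum.
  let T : Set (E × E) := {z | ‖z.1‖ ^ p + ‖z.2‖ ^ p = 1} ∩ {z | ε ≤ ‖z.1 - z.2‖ ^ p}
  have hT : IsCompact T := by
    refine Metric.isCompact_of_isClosed_isBounded
      ((isClosed_eq c1 continuous_const).inter (isClosed_le continuous_const c2)) ?_
    refine (Metric.isBounded_closedBall (x := (0 : E × E)) (r := 1)).subset fun z hz => ?_
    have hz1 : ‖z.1‖ ^ p + ‖z.2‖ ^ p = 1 := hz.1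
    have key (s : ℝ) (hs : 0 ≤ s) (h : s ^ p ≤ 1) : s ≤ 1 :=
      by
      by_contra h1
      exact absurd (Real.one_lt_rpow (not_le.1 h1) hp0) (not_lt.2 h)
    rw [mem_closedBall_zero_iff, Prod.norm_def]
    exact max_le (key _ (norm_nonneg _) (by linarith [Real.rpow_nonneg (norm_nonneg z.2) p]))
      (key _ (norm_nonneg _) (by linarith [Real.rpow_nonneg (norm_nonneg z.1) p]))
  have hunit : ∃ C : ℝ, 0 ≤ C ∧ ∀ a b : E, ‖a‖ ^ p + ‖b‖ ^ p = 1 → ‖a - b‖ ^ p ≤ ε +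
      C * ((‖a‖ ^ p + ‖b‖ ^ p) / 2 - ‖(1 / 2 : ℝ) • (a + b)‖ ^ p) := by
    by_cases hTn : T.Nonempty
    · obtain ⟨z, hz, hzmin⟩ := hT.exists_isMinOn hTn c3.continuousOn
      obtain ⟨y, hy, hymax⟩ := hT.exists_isMaxOn hTn c2.continuousOn
      set δ := (‖z.1‖ ^ p + ‖z.2‖ ^ p) / 2 - ‖(1 / 2 : ℝ) • (z.1 + z.2)‖ ^ p with hδ
      have hne : z.1 ≠ z.2 := fun h => by
        have : ε ≤ ‖z.1 - z.2‖ ^ p := hz.2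
        rw [h, sub_self, norm_zero, Real.zero_rpow hp0.ne'] at this
        linarith
      have hδ0 : 0 < δ := sub_pos.2 (norm_midpoint_rpow_lt hp hne)
      refine ⟨‖y.1 - y.2‖ ^ p / δ, by positivity, fun a b hab => ?_⟩
      by_cases h : ε ≤ ‖a - b‖ ^ p
      · have hmem : (a, b) ∈ T := ⟨hab, h⟩
        have h1 : ‖a - b‖ ^ p ≤ ‖y.1 - y.2‖ ^ p := hymax hmem
        have h2 : δ ≤ (‖a‖ ^ p + ‖b‖ ^ p) / 2 - ‖(1 / 2 : ℝ) • (a + b)‖ ^ p := hzmin hmem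
        calc ‖a - b‖ ^ p ≤ ‖y.1 - y.2‖ ^ p / δ * δ := by
              rwa [div_mul_cancel₀ _ hδ0.ne']
          _ ≤ ‖y.1 - y.2‖ ^ p / δ *
              ((‖a‖ ^ p + ‖b‖ ^ p) / 2 - ‖(1 / 2 : ℝ) • (a + b)‖ ^ p) := by gcongr
          _ ≤ _ := by linarith
      · have := mul_nonneg (show 0 ≤ ‖y.1 - y.2‖ ^ p / δ by positivity) (hnn a b)
        linarith [not_le.1 h]
    · refine ⟨0, le_rfl, fun a b hab => ?_⟩
      have : ¬ ε ≤ ‖a - b‖ ^ p := fun h => hTn ⟨(a, b), hab, h⟩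
      linarith [not_le.1 this]
  obtain ⟨C, hC0, hC⟩ := hunit
  refine ⟨C, hC0, fun a b => ?_⟩
  set s := ‖a‖ ^ p + ‖b‖ ^ p with hs
  have ha0 := Real.rpow_nonneg (norm_nonneg a) p
  have hb0 := Real.rpow_nonneg (norm_nonneg b) p
  rcases (show 0 ≤ s by positivity).eq_or_lt with h0 | hspos
  · have ha : a = 0 := by
      have : ‖a‖ ^ p = 0 := by linarith
      exact norm_eq_zero.1 ((Real.rpow_eq_zero (norm_nonneg _) hp0.ne').1 this)
    have hb : b = 0 := by
      have : ‖b‖ ^ p = 0 := by linarith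
      exact norm_eq_zero.1 ((Real.rpow_eq_zero (norm_nonneg _) hp0.ne').1 this)
    rw [← h0, ha, hb]
    simp [Real.zero_rpow hp0.ne']
  -- Both sides are homogeneous of degree `p`; this factor normalises `‖a‖ ^ p + ‖b‖ ^ p` to `1`.
  · set c : ℝ := s ^ (-(1 / p)) with hc
    have hc0 : 0 < c := Real.rpow_pos_of_pos hspos _
    have hcp : c ^ p = s⁻¹ := by
      rw [hc, ← Real.rpow_mul hspos.le, neg_mul, one_div_mul_cancel hp0.ne', Real.rpow_neg_one]
    have hsm (x : E) : ‖c • x‖ ^ p = s⁻¹ * ‖x‖ ^ p := by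
      rw [norm_smul, Real.norm_of_nonneg hc0.le, Real.mul_rpow hc0.le (norm_nonneg _), hcp]
    have h := hC (c • a) (c • b) (by rw [hsm, hsm, ← mul_add]; exact inv_mul_cancel₀ hspos.ne')
    rw [← smul_sub, ← smul_add, smul_comm, hsm, hsm, hsm, hsm] at h
    have h' := mul_le_mul_of_nonneg_left h hspos.le
    have e1 : s * (s⁻¹ * ‖a - b‖ ^ p) = ‖a - b‖ ^ p := by field_simp
    rw [e1] at h'
    refine h'.trans_eq ?_
    rw [mul_add]
    field_simp
    rw [hs]

end UniformConvexity

/-! ### Uniform convexity transferred to `W_0^{1,p}(Ω)` -/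

section NormPower

variable {N : ℕ} {Ω : BoundedDomain N} {p : ℝ} [hp : Fact (1 < p)]

theorem W0.integrable_grad_rpow (u : W0 Ω p) :
    Integrable (fun x => ‖W0.grad Ω p u x‖ ^ p) Ω.measure := by
  have hp0 : 0 < p := zero_lt_one.trans hp.out
  have h := (Lp.memLp (W0.grad Ω p u)).integrable_norm_rpow (by simpa using hp0)
    ENNReal.ofReal_ne_top
  rwa [ENNReal.toReal_ofReal hp0.le] at h

/-- The quantitative uniform convexity of `u ↦ ‖u‖ ^ p` on `W_0^{1,p}(Ω)`. -/
theorem W0.exists_uniform_convexity [NeZero N] {ε : ℝ} (hε : 0 < ε) :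
    ∃ C : ℝ, 0 ≤ C ∧ ∀ u v : W0 Ω p, ‖u - v‖ ^ p ≤ ε * (‖u‖ ^ p + ‖v‖ ^ p) +
      C * ((‖u‖ ^ p + ‖v‖ ^ p) / 2 - ‖(1 / 2 : ℝ) • (u + v)‖ ^ p) := by
  obtain ⟨C, hC0, hC⟩ := Kirchhoff.exists_uniform_convexity (E := Space N) hp.out hε
  refine ⟨C, hC0, fun u v => ?_⟩
  have hu := W0.integrable_grad_rpow u
  have hv := W0.integrable_grad_rpow v
  have hm := W0.integrable_grad_rpow ((1 / 2 : ℝ) • (u + v))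
  have hs := W0.integrable_grad_rpow (u - v)
  have huv : Integrable (fun x => ‖W0.grad Ω p u x‖ ^ p + ‖W0.grad Ω p v x‖ ^ p) Ω.measure :=
    hu.add hv
  have hd : Integrable (fun x => (‖W0.grad Ω p u x‖ ^ p + ‖W0.grad Ω p v x‖ ^ p) / 2 -
      ‖W0.grad Ω p ((1 / 2 : ℝ) • (u + v)) x‖ ^ p) Ω.measure := (huv.div_const 2).sub hm
  simp only [W0.norm_rpow_eq]
  rw [← integral_add hu hv, ← integral_div, ← integral_const_mul,
    ← integral_sub (huv.div_const 2) hm, ← integral_const_mul,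
    ← integral_add (huv.const_mul ε) (hd.const_mul C)]
  refine integral_mono_ae hs ((huv.const_mul ε).add (hd.const_mul C)) ?_
  have h1 : W0.grad Ω p (u - v) =ᵐ[Ω.measure]
      fun x => W0.grad Ω p u x - W0.grad Ω p v x := by
    rw [map_sub]
    exact Lp.coeFn_sub _ _
  have h2 : W0.grad Ω p ((1 / 2 : ℝ) • (u + v)) =ᵐ[Ω.measure]
      fun x => (1 / 2 : ℝ) • (W0.grad Ω p u x + W0.grad Ω p v x) := by
    rw [map_smul, map_add]
    filter_upwards [Lp.coeFn_smul (1 / 2 : ℝ) (W0.grad Ω p u + W0.grad Ω p v),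
      Lp.coeFn_add (W0.grad Ω p u) (W0.grad Ω p v)] with x hx hx'
    rw [hx, Pi.smul_apply, hx', Pi.add_apply]
  filter_upwards [h1, h2] with x hx hx'
  simp only [hx, hx']
  exact hC _ _

end NormPower

/-! ### The primitive of `M` -/

section KirchhoffCoefficient

variable {M : ℝ → ℝ}

theorem IsKirchhoffCoefficient.intervalIntegrable (hM : IsKirchhoffCoefficient M) {t : ℝ}
    (ht : 0 ≤ t) : IntervalIntegrable M volume 0 t := by
  rcases ht.eq_or_lt with rfl | ht
  · exact IntervalIntegrable.refl
  · refine hM.integrable.trans (hM.continuousOn.mono ?_).intervalIntegrable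
    intro s hs
    exact (lt_min one_pos ht).trans_le hs.1

theorem IsKirchhoffCoefficient.hasDerivAt_primitive (hM : IsKirchhoffCoefficient M) {t : ℝ}
    (ht : 0 < t) : HasDerivAt (primitive M) (M t) t :=
  intervalIntegral.integral_hasDerivAt_right (hM.intervalIntegrable ht.le)
    (hM.continuousOn.stronglyMeasurableAtFilter isOpen_Ioi t ht)
    (hM.continuousOn.continuousAt (Ioi_mem_nhds ht))

theorem IsKirchhoffCoefficient.primitive_mono (hM : IsKirchhoffCoefficient M)
    (hpos : ∀ t, 0 < t → 0 < M t) {a b : ℝ} (ha : 0 ≤ a) (hab : a ≤ b) :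
    primitive M a ≤ primitive M b := by
  have h := intervalIntegral.integral_interval_sub_left
    (hM.intervalIntegrable (ha.trans hab)) (hM.intervalIntegrable ha)
  have h2 : 0 ≤ ∫ s in a..b, M s := by
    rw [intervalIntegral.integral_of_le hab]
    exact setIntegral_nonneg measurableSet_Ioc fun s hs => (hpos s (ha.trans_lt hs.1)).le
  unfold primitive
  linarith

end KirchhoffCoefficient

/-! ### Derivative of the energy and boundedness of sequences -/

section Energy

variable {N : ℕ} [NeZero N] {Ω : BoundedDomain N} {p : ℝ} [hp : Fact (1 < p)]
  {M : ℝ → ℝ} {f : Space N → ℝ → ℝ} {ϖ : ℝ}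

theorem W0.exists_integral_rpow_le (Ω : BoundedDomain N) (p : ℝ) [hp : Fact (1 < p)] {q : ℝ}
    (hq : 1 ≤ q) (hqp : (q : EReal) < criticalExponent N p) :
    ∃ K : ℝ, 0 ≤ K ∧ ∀ u : W0 Ω p, MemLp u (ENNReal.ofReal q) Ω.measure ∧
      ∫ x in Ω.carrier, |u x| ^ q ≤ (K * ‖u‖) ^ q := by
  obtain ⟨K, hK0, hK⟩ := W0.exists_sobolev Ω p hq hqp
  have hq0 : 0 < q := by linarith
  refine ⟨K, hK0, fun u => ?_⟩
  have hmem : MemLp u (ENNReal.ofReal q) Ω.measure :=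
    ⟨u.aestronglyMeasurable, (hK u).trans_lt ENNReal.ofReal_lt_top⟩
  refine ⟨hmem, ?_⟩
  have h0 : 0 ≤ ∫ x in Ω.carrier, |u x| ^ q := integral_nonneg fun x => by positivity
  have h := hK u
  rw [hmem.eLpNorm_eq_integral_rpow_norm (by simpa using hq0) ENNReal.ofReal_ne_top,
    ENNReal.ofReal_le_ofReal_iff (by positivity), ENNReal.toReal_ofReal hq0.le] at h
  simp only [Real.norm_eq_abs] at h
  calc ∫ x in Ω.carrier, |u x| ^ q = ((∫ x in Ω.carrier, |u x| ^ q) ^ q⁻¹) ^ q := by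
        rw [← Real.rpow_mul h0, inv_mul_cancel₀ hq0.ne', Real.rpow_one]
    _ ≤ (K * ‖u‖) ^ q := Real.rpow_le_rpow (by positivity) h hq0.le

theorem SubcriticalGrowth.memLp (hf : SubcriticalGrowth Ω p f ϖ) (u : W0 Ω p) :
    MemLp u (ENNReal.ofReal ϖ) Ω.measure := by
  obtain ⟨K, -, hK⟩ := W0.exists_integral_rpow_le Ω p hf.one_lt.le hf.lt_critical
  exact (hK u).1

/-- Differentiability of `J` at `u` is given, and the integral term is differentiable along lines;
so the norm term is too, without computing its derivative. -/
theorem SubcriticalGrowth.hasDerivAt_norm_term (hf : SubcriticalGrowth Ω p f ϖ) {u : W0 Ω p}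
    (hd : DifferentiableAt ℝ (energy Ω p M f) u) (v : W0 Ω p) :
    HasDerivAt (fun t : ℝ => 1 / p * primitive M (‖u + t • v‖ ^ p))
      (fderiv ℝ (energy Ω p M f) u v + ∫ x in Ω.carrier, f x (u x) * v x) 0 := by
  have h1 : HasDerivAt (fun t : ℝ => u + t • v) v 0 := by
    simpa using ((hasDerivAt_id (0 : ℝ)).smul_const v).const_add u
  have h2 : HasDerivAt (fun t : ℝ => energy Ω p M f (u + t • v))
      (fderiv ℝ (energy Ω p M f) u v) 0 := by
    have h0 : HasFDerivAt (energy Ω p M f) (fderiv ℝ (energy Ω p M f) u) (u + (0 : ℝ) • v) := by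
      rw [zero_smul, add_zero]
      exact hd.hasFDerivAt
    exact h0.comp_hasDerivAt (0 : ℝ) h1
  have h3 := (hf.hasDerivAt_integral_primitive (hf.memLp u) (hf.memLp v)).2
  refine (h2.add h3).congr_of_eventuallyEq (Eventually.of_forall fun t => ?_)
  have h4 : ∫ x in Ω.carrier, primitive (f x) ((u + t • v : W0 Ω p) x) =
      ∫ x in Ω.carrier, primitive (f x) (u x + t * v x) := by
    refine integral_congr_ae ?_
    filter_upwards [W0.coeFn_add u (t • v), W0.coeFn_smul t v] with x hx hx'
    rw [hx, hx']
  simp only [energy, Pi.add_apply, h4]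
  ring

/-- Along the ray through `u` the norm term is explicit, and uniqueness of derivatives identifies
`J'(u)u`. At `u = 0` both sides vanish whatever `M 0` is. -/
theorem SubcriticalGrowth.fderiv_self (hM : IsKirchhoffCoefficient M)
    (hf : SubcriticalGrowth Ω p f ϖ) {u : W0 Ω p}
    (hd : DifferentiableAt ℝ (energy Ω p M f) u) :
    fderiv ℝ (energy Ω p M f) u u =
      M (‖u‖ ^ p) * ‖u‖ ^ p - ∫ x in Ω.carrier, f x (u x) * u x := by
  have hp0 : 0 < p := zero_lt_one.trans hp.out
  by_cases hu : u = 0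
  · have h0 : ∫ x in Ω.carrier, f x (u x) * u x = 0 := by
      refine integral_eq_zero_of_ae ?_
      have h : (u : Space N → ℝ) =ᵐ[Ω.measure] 0 := by
        rw [hu]
        exact Lp.coeFn_zero _ _ _
      filter_upwards [h] with x hx
      simp [hx]
    rw [h0, hu]
    simp [Real.zero_rpow hp0.ne']
  · have hn : 0 < ‖u‖ := norm_pos_iff.2 hu
    have hs : 0 < ‖u‖ ^ p := Real.rpow_pos_of_pos hn p
    have h1 : HasDerivAt (fun t : ℝ => (1 + t) ^ p * ‖u‖ ^ p) (p * ‖u‖ ^ p) 0 := by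
      have := (((hasDerivAt_id (0 : ℝ)).const_add 1).rpow_const (p := p)
        (Or.inl (by simp))).mul_const (‖u‖ ^ p)
      simpa using this
    have h2 : HasDerivAt (fun t : ℝ => 1 / p * primitive M ((1 + t) ^ p * ‖u‖ ^ p))
        (1 / p * (M (‖u‖ ^ p) * (p * ‖u‖ ^ p))) 0 := by
      have h0 : HasDerivAt (primitive M) (M (‖u‖ ^ p)) ((1 + 0) ^ p * ‖u‖ ^ p) := by
        simpa using hM.hasDerivAt_primitive hs
      exact (h0.comp (0 : ℝ) h1).const_mul (1 / p)
    have h3 := hf.hasDerivAt_norm_term hd u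
    have h4 : (fun t : ℝ => 1 / p * primitive M (‖u + t • u‖ ^ p)) =ᶠ[𝓝 0]
        fun t : ℝ => 1 / p * primitive M ((1 + t) ^ p * ‖u‖ ^ p) := by
      filter_upwards [lt_mem_nhds (show (-1 : ℝ) < 0 by norm_num)] with t ht
      have : u + t • u = (1 + t) • u := by rw [add_smul, one_smul]
      rw [this, norm_smul, Real.norm_of_nonneg (by linarith),
        Real.mul_rpow (by linarith) hn.le]
    have h5 := h3.unique (h2.congr_of_eventuallyEq h4)
    have h6 : 1 / p * (M (‖u‖ ^ p) * (p * ‖u‖ ^ p)) = M (‖u‖ ^ p) * ‖u‖ ^ p := by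
      field_simp
    linarith

/-- The estimate behind conditions of Ambrosetti-Rabinowitz type. -/
theorem SubcriticalGrowth.exists_le_of_ambrosetti_rabinowitz (hM : IsKirchhoffCoefficient M)
    (hf : SubcriticalGrowth Ω p f ϖ) {r C : ℝ}
    (h : ∀ x ∈ Ω.carrier, ∀ v : ℝ, r * primitive (f x) v - f x v * v ≤ C) :
    ∃ D : ℝ, ∀ u : W0 Ω p, DifferentiableAt ℝ (energy Ω p M f) u →
      r / p * primitive M (‖u‖ ^ p) - M (‖u‖ ^ p) * ‖u‖ ^ p ≤
        r * energy Ω p M f u - fderiv ℝ (energy Ω p M f) u u + D := by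
  refine ⟨Ω.measure.real univ * C, fun u hd => ?_⟩
  rw [hf.fderiv_self hM hd]
  have h1 := hf.integrable_primitive (hf.memLp u)
  have h2 := (hf.hasDerivAt_integral_primitive (hf.memLp u) (hf.memLp u)).1
  have h3 : r * (∫ x in Ω.carrier, primitive (f x) (u x)) - ∫ x in Ω.carrier, f x (u x) * u x ≤
      Ω.measure.real univ * C := by
    rw [← integral_const_mul, ← integral_sub (h1.const_mul r) h2]
    refine (integral_mono_ae ((h1.const_mul r).sub h2) (integrable_const C) ?_).trans_eq ?_
    · filter_upwards [ae_restrict_mem Ω.isOpen.measurableSet] with x hx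
      exact h x hx (u x)
    · simp
  have h4 : r * energy Ω p M f u = r / p * primitive M (‖u‖ ^ p) -
      r * ∫ x in Ω.carrier, primitive (f x) (u x) := by
    unfold energy
    ring
  linarith

theorem SubcriticalGrowth.exists_abs_integral_primitive_le (hf : SubcriticalGrowth Ω p f ϖ) :
    ∃ D : ℝ, 0 ≤ D ∧ ∀ u : W0 Ω p,
      |∫ x in Ω.carrier, primitive (f x) (u x)| ≤ D * (1 + ‖u‖ ^ ϖ) := by
  obtain ⟨C, hC, hg⟩ := hf.ae_abs_primitive_le
  have hϖ := hf.one_lt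
  obtain ⟨K, hK0, hK⟩ := W0.exists_integral_rpow_le Ω p hf.one_lt.le hf.lt_critical
  refine ⟨C * (Ω.measure.real univ + K ^ ϖ), by positivity, fun u => ?_⟩
  have h1 := integrable_abs_rpow_of_memLp (by linarith) (hK u).1
  have h2 : |∫ x in Ω.carrier, primitive (f x) (u x)| ≤
      ∫ x in Ω.carrier, C * (1 + |u x| ^ ϖ) := by
    refine norm_integral_le_of_norm_le (μ := Ω.measure) (f := fun x => primitive (f x) (u x)) (((integrable_const 1).add h1).const_mul C) ?_
    filter_upwards [ae_restrict_mem Ω.isOpen.measurableSet] with x hx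
    exact hg x hx (u x)
  have h3 : ∫ x in Ω.carrier, C * (1 + |u x| ^ ϖ) =
      C * (Ω.measure.real univ + ∫ x in Ω.carrier, |u x| ^ ϖ) := by
    rw [integral_const_mul, integral_add (integrable_const 1) h1]
    simp
  rw [h3] at h2
  refine h2.trans ?_
  rw [mul_assoc]
  refine mul_le_mul_of_nonneg_left ?_ hC.le
  have h4 := (hK u).2
  rw [Real.mul_rpow hK0 (norm_nonneg _)] at h4
  have h5 : 0 ≤ Ω.measure.real univ * ‖u‖ ^ ϖ := by positivity
  have h6 : 0 ≤ K ^ ϖ := by positivity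
  linarith

/-- Under `K_C` the functional is coercive. -/
theorem SubcriticalGrowth.exists_norm_le_of_coercive (hf : SubcriticalGrowth Ω p f ϖ)
    (hC : ConditionC p M ϖ) (B : ℝ) :
    ∃ K : ℝ, ∀ u : W0 Ω p, energy Ω p M f u ≤ B → ‖u‖ ≤ K := by
  have hp0 : 0 < p := zero_lt_one.trans hp.out
  obtain ⟨r, C, hr, hC0, h⟩ := hC
  obtain ⟨D, hD0, hD⟩ := hf.exists_abs_integral_primitive_le
  have hϖ := hf.one_lt
  -- When `‖u‖ ≥ 1`, all constants are absorbed into `‖u‖ ^ ϖ`, and `J(u) ≤ B` forces `‖u‖ ^ r ≤ A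
  -- ‖u‖ ^ ϖ`.
  set A : ℝ := p * (|B| + 2 * D) + C with hA
  have hA0 : 0 < A := by positivity
  refine ⟨max 1 (A ^ (r - ϖ)⁻¹), fun u hu => ?_⟩
  by_contra! hlt
  obtain ⟨h1, h2⟩ := max_lt_iff.1 hlt
  have h3 : A < ‖u‖ ^ (r - ϖ) := by
    rwa [Real.rpow_inv_lt_iff_of_pos hA0.le (norm_nonneg _) (by linarith)] at h2
  have h4 : 1 ≤ ‖u‖ ^ ϖ := Real.one_le_rpow h1.le (by linarith)
  have h5 : ‖u‖ ^ r = ‖u‖ ^ (r - ϖ) * ‖u‖ ^ ϖ := by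
    rw [← Real.rpow_add (by linarith)]
    congr 1
    ring
  have h6 : A * ‖u‖ ^ ϖ < ‖u‖ ^ r := by
    rw [h5]
    gcongr
  have h7 := h ‖u‖ (norm_nonneg _)
  have h8 := (abs_le.1 (hD u)).2
  have h9 : primitive M (‖u‖ ^ p) ≤ p * (|B| + D * (1 + ‖u‖ ^ ϖ)) := by
    rw [energy] at hu
    have : 1 / p * primitive M (‖u‖ ^ p) ≤ |B| + D * (1 + ‖u‖ ^ ϖ) := by
      linarith [le_abs_self B]
    rwa [one_div, inv_mul_le_iff₀ hp0] at this
  have h10 : p * (|B| + D * (1 + ‖u‖ ^ ϖ)) ≤ p * ((|B| + 2 * D) * ‖u‖ ^ ϖ) := by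
    refine mul_le_mul_of_nonneg_left ?_ hp0.le
    nlinarith [abs_nonneg B]
  have h11 : C ≤ C * ‖u‖ ^ ϖ := le_mul_of_one_le_right hC0.le h4
  have h12 : A * ‖u‖ ^ ϖ = p * ((|B| + 2 * D) * ‖u‖ ^ ϖ) + C * ‖u‖ ^ ϖ := by
    rw [hA]
    ring
  linarith

theorem isBounded_range_of_eventually_le {X : Type*} [NormedAddCommGroup X] {u : ℕ → X} {K : ℝ}
    (h : ∀ᶠ n in atTop, ‖u n‖ ≤ K) : Bornology.IsBounded (range u) := by
  obtain ⟨n₀, hn₀⟩ := eventually_atTop.1 h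
  have h1 : range u ⊆ u '' (Finset.range n₀) ∪ Metric.closedBall 0 K := by
    rintro _ ⟨n, rfl⟩
    rcases lt_or_ge n n₀ with hn | hn
    · exact Or.inl ⟨n, by simpa using hn, rfl⟩
    · exact Or.inr (mem_closedBall_zero_iff.2 (hn₀ n hn))
  exact (((Finset.finite_toSet _).image u).isBounded.union Metric.isBounded_closedBall).subset h1

theorem SubcriticalGrowth.isBounded_of_coercive (hf : SubcriticalGrowth Ω p f ϖ)
    (hC : ConditionC p M ϖ) {u : ℕ → W0 Ω p} {B : ℝ} (hB : ∀ n, |energy Ω p M f (u n)| ≤ B) :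
    Bornology.IsBounded (range u) := by
  obtain ⟨K, hK⟩ := hf.exists_norm_le_of_coercive hC B
  exact isBounded_range_of_eventually_le
    (Eventually.of_forall fun n => hK _ ((le_abs_self _).trans (hB n)))

theorem SubcriticalGrowth.isBounded_of_isPSSequence (hM : IsKirchhoffCoefficient M)
    (hf : SubcriticalGrowth Ω p f ϖ) (hAR : ConditionAR Ω p M f) {u : ℕ → W0 Ω p}
    (hu : IsPSSequence (energy Ω p M f) u) : Bornology.IsBounded (range u) := by
  obtain ⟨r, C, β, hr, hC, hβ, h1, h2⟩ := hAR
  obtain ⟨⟨B, hB⟩, hd, hlim⟩ := hu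
  obtain ⟨D, hD⟩ := hf.exists_le_of_ambrosetti_rabinowitz hM h1
  -- Half of `β ‖u‖` absorbs `J'(u)u` once `‖J'(u)‖ < β / 2`; the other half yields the bound.
  refine isBounded_range_of_eventually_le (K := (r * B + D + C) / (β / 2)) ?_
  filter_upwards [hlim.eventually_lt_const (half_pos hβ)] with n hn
  rw [le_div_iff₀ (half_pos hβ)]
  have h3 := hD (u n) (hd n)
  have h4 := h2 ‖u n‖ (norm_nonneg _)
  have h5 := (fderiv ℝ (energy Ω p M f) (u n)).le_opNorm (u n)
  have h6 := neg_le_of_abs_le h5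
  have h7 : ‖fderiv ℝ (energy Ω p M f) (u n)‖ * ‖u n‖ ≤ β / 2 * ‖u n‖ := by gcongr
  have h8 : r * energy Ω p M f (u n) ≤ r * B := by
    gcongr
    exact (le_abs_self _).trans (hB n)
  linarith

theorem SubcriticalGrowth.isBounded_of_isCeramiSequence (hM : IsKirchhoffCoefficient M)
    (hf : SubcriticalGrowth Ω p f ϖ) (hAR : ConditionARWeak Ω p M f) {u : ℕ → W0 Ω p}
    (hu : IsCeramiSequence (energy Ω p M f) u) : Bornology.IsBounded (range u) := by
  obtain ⟨r, C, β, hr, hC, hβ, h1, h, hh, h2⟩ := hAR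
  obtain ⟨⟨B, hB⟩, hd, hlim⟩ := hu
  obtain ⟨D, hD⟩ := hf.exists_le_of_ambrosetti_rabinowitz hM h1
  set A := (r * B + D + C + 1) / β with hA
  refine isBounded_range_of_eventually_le (K := A ^ h⁻¹) ?_
  filter_upwards [hlim.eventually_lt_const one_pos] with n hn
  have h3 := hD (u n) (hd n)
  have h4 := h2 ‖u n‖ (norm_nonneg _)
  have h5 := (fderiv ℝ (energy Ω p M f) (u n)).le_opNorm (u n)
  have h6 := neg_le_of_abs_le h5
  -- The weight `1 + ‖u‖` bounds `J'(u)u` itself, so nothing has to be absorbed and the exponent `h`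
  -- may be below `1`.
  have h7 : ‖fderiv ℝ (energy Ω p M f) (u n)‖ * ‖u n‖ ≤ 1 := by
    linarith [norm_nonneg (fderiv ℝ (energy Ω p M f) (u n))]
  have h8 : r * energy Ω p M f (u n) ≤ r * B := by
    gcongr
    exact (le_abs_self _).trans (hB n)
  have h9 : ‖u n‖ ^ h ≤ A := by
    rw [hA, le_div_iff₀ hβ]
    linarith
  calc ‖u n‖ = (‖u n‖ ^ h) ^ h⁻¹ := by
        rw [← Real.rpow_mul (norm_nonneg _), mul_inv_cancel₀ hh.ne', Real.rpow_one]
    _ ≤ A ^ h⁻¹ := Real.rpow_le_rpow (by positivity) h9 (by positivity)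

end Energy

/-- Transfers a one-sided comparison with an explicit function to the derivative of the norm term,
for which no formula is available. -/
theorem deriv_le_of_le_right {k l : ℝ → ℝ} {k' l' δ : ℝ} (hk : HasDerivAt k k' 0)
    (hl : HasDerivAt l l' 0) (h0 : k 0 = l 0) (hδ : 0 < δ) (h : ∀ t ∈ Ioo 0 δ, k t ≤ l t) :
    k' ≤ l' := by
  have h1 := (hl.sub hk).hasDerivWithinAt (s := Ioi 0)
  rw [hasDerivWithinAt_iff_tendsto_slope' self_notMem_Ioi] at h1
  rw [← sub_nonneg]
  refine ge_of_tendsto h1 ?_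
  filter_upwards [Ioo_mem_nhdsGT hδ] with t ht
  rw [slope_def_field]
  simp only [Pi.sub_apply, h0, sub_self, sub_zero]
  exact div_nonneg (sub_nonneg.2 (h t ht)) ht.1.le

/-! ### Convergence of bounded sequences with vanishing derivative -/

section Compactness

variable {N : ℕ} [NeZero N] {Ω : BoundedDomain N} {p : ℝ} [hp : Fact (1 < p)]
  {M : ℝ → ℝ} {f : Space N → ℝ → ℝ} {ϖ : ℝ}

/-- Moving from `u` half-way towards `u + v` decreases `‖·‖ ^ p` by at most a multiple of the
derivative of the norm term of the energy in direction `v`. -/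
theorem SubcriticalGrowth.norm_rpow_sub_midpoint_le (hM : IsKirchhoffCoefficient M)
    (hpos : ∀ t, 0 < t → 0 < M t) (hf : SubcriticalGrowth Ω p f ϖ) {u : W0 Ω p} (hu : u ≠ 0)
    (hd : DifferentiableAt ℝ (energy Ω p M f) u) (v : W0 Ω p) :
    2 * M (‖u‖ ^ p) * (‖u‖ ^ p - ‖u + (1 / 2 : ℝ) • v‖ ^ p) ≤
      p * |fderiv ℝ (energy Ω p M f) u v + ∫ x in Ω.carrier, f x (u x) * v x| := by
  have hp1 := hp.out
  have hp0 : 0 < p := zero_lt_one.trans hp1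
  set a := ‖u‖ ^ p with ha
  set b := ‖u + (1 / 2 : ℝ) • v‖ ^ p with hb
  have ha0 : 0 < a := Real.rpow_pos_of_pos (norm_pos_iff.2 hu) p
  have hb0 : 0 ≤ b := by positivity
  have hMa := hpos a ha0
  rcases le_or_gt a b with hab | hab
  · have h1 : 2 * M a * (a - b) ≤ 0 := mul_nonpos_of_nonneg_of_nonpos (by positivity) (by linarith)
    exact h1.trans (by positivity)
  · have hk := hf.hasDerivAt_norm_term hd v
    have h1 : HasDerivAt (fun t : ℝ => a - 2 * t * (a - b)) (-(2 * (a - b))) 0 := by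
      simpa using ((((hasDerivAt_id (0 : ℝ)).const_mul 2).mul_const (a - b)).const_sub a)
    have h0 : HasDerivAt (primitive M) (M a) (a - 2 * 0 * (a - b)) := by
      simpa using hM.hasDerivAt_primitive ha0
    have hl : HasDerivAt (fun t : ℝ => 1 / p * primitive M (a - 2 * t * (a - b)))
        (1 / p * (M a * -(2 * (a - b)))) 0 := (h0.comp (0 : ℝ) h1).const_mul (1 / p)
    have h2 := deriv_le_of_le_right hk hl (by simp [ha]) (show (0 : ℝ) < 1 / 2 by norm_num) ?_
    · have h3 := neg_abs_le (fderiv ℝ (energy Ω p M f) u v + ∫ x in Ω.carrier, f x (u x) * v x)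
      have h4 := h3.trans h2
      rw [one_div, ← div_eq_inv_mul, le_div_iff₀ hp0] at h4
      linarith
    · intro t ht
      -- For `0 < t < 1/2` the point lies on the segment from `u` to `u + v/2`, with weight `2t` at
      -- the far end, so convexity gives the affine bound `h4`.
      have h3 : u + t • v = (1 - 2 * t) • u + (2 * t) • (u + (1 / 2 : ℝ) • v) := by
        module
      have h4 : ‖u + t • v‖ ^ p ≤ a - 2 * t * (a - b) := by
        have h5 : ‖u + t • v‖ ≤ (1 - 2 * t) * ‖u‖ + (2 * t) * ‖u + (1 / 2 : ℝ) • v‖ := by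
          rw [h3]
          refine (norm_add_le _ _).trans ?_
          rw [norm_smul, norm_smul, Real.norm_of_nonneg (by linarith [ht.2]),
            Real.norm_of_nonneg (by linarith [ht.1])]
        have h6 := (convexOn_rpow hp1.le).2 (norm_nonneg u)
          (norm_nonneg (u + (1 / 2 : ℝ) • v)) (show 0 ≤ 1 - 2 * t by linarith [ht.2])
          (show 0 ≤ 2 * t by linarith [ht.1]) (by ring)
        simp only [smul_eq_mul] at h6
        refine (Real.rpow_le_rpow (norm_nonneg _) h5 hp0.le).trans (h6.trans_eq ?_)
        ring
      refine mul_le_mul_of_nonneg_left (hM.primitive_mono hpos (by positivity) h4) (by positivity)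

/-- The nonlinear term is small in directions that are bounded in `W_0^{1,p}(Ω)` and small in
`L¹(Ω)`. -/
theorem SubcriticalGrowth.exists_abs_integral_mul_le (hf : SubcriticalGrowth Ω p f ϖ) (B : ℝ)
    {ε : ℝ} (hε : 0 < ε) :
    ∃ δ : ℝ, 0 < δ ∧ ∀ u v : W0 Ω p, ‖u‖ ≤ B → ‖v‖ ≤ B →
      eLpNorm v 1 Ω.measure ≤ ENNReal.ofReal δ →
      |∫ x in Ω.carrier, f x (u x) * v x| ≤ ε := by
  have hϖ := hf.one_lt
  -- The room between `ϖ` and `p^*` makes the part with `|u| > T` of size `T ^ (ϖ - q)`; after `T`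
  -- is fixed, the rest is controlled by the `L¹` norm of `v`.
  obtain ⟨q, hϖq, hqp⟩ := EReal.lt_iff_exists_real_btwn.1 hf.lt_critical
  have hϖq' : ϖ < q := by exact_mod_cast hϖq
  obtain ⟨K, hK0, hK⟩ := W0.exists_integral_rpow_le Ω p (by linarith) hqp
  obtain ⟨C₀, hC, hg⟩ := hf.growth
  set A : ℝ := 2 * (K * |B|) ^ q with hA
  have hA0 : 0 ≤ A := by positivity
  have hT : Tendsto (fun T : ℝ => C₀ * (T ^ (ϖ - q) * A)) atTop (𝓝 0) := by
    have h1 := tendsto_rpow_neg_atTop (show 0 < q - ϖ by linarith)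
    rw [neg_sub] at h1
    simpa using (h1.mul_const A).const_mul C₀
  obtain ⟨T, hT1, hT0⟩ := ((hT.eventually_lt_const (half_pos hε)).and
    (eventually_gt_atTop 0)).exists
  have hL : 0 < C₀ * (1 + T ^ (ϖ - 1)) := by positivity
  refine ⟨ε / 2 / (C₀ * (1 + T ^ (ϖ - 1))), by positivity, fun u v hu hv hδ => ?_⟩
  have hbd (w : W0 Ω p) (hw : ‖w‖ ≤ B) : ∫ x in Ω.carrier, |w x| ^ q ≤ (K * |B|) ^ q := by
    refine (hK w).2.trans ?_
    have : ‖w‖ ≤ |B| := hw.trans (le_abs_self B)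
    exact Real.rpow_le_rpow (by positivity) (by gcongr) (by linarith)
  have hiu := integrable_abs_rpow_of_memLp (by linarith) (hK u).1
  have hiv := integrable_abs_rpow_of_memLp (by linarith) (hK v).1
  have hv0 : Integrable v Ω.measure :=
    (hK v).1.integrable (by simpa using (by linarith : 1 ≤ q))
  have hv1 : Integrable (fun x => |v x|) Ω.measure := hv0.abs
  have hv2 : ∫ x in Ω.carrier, |v x| ≤ ε / 2 / (C₀ * (1 + T ^ (ϖ - 1))) := by
    rw [eLpNorm_one_eq_lintegral_enorm, ← ofReal_integral_norm_eq_lintegral_enorm hv0,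
      ENNReal.ofReal_le_ofReal_iff (by positivity)] at hδ
    exact hδ
  have hsum : Integrable (fun x => |u x| ^ q + |v x| ^ q) Ω.measure := hiu.add hiv
  have h1 : |∫ x in Ω.carrier, f x (u x) * v x| ≤ ∫ x in Ω.carrier,
      ((C₀ * (1 + T ^ (ϖ - 1))) * |v x| + C₀ * T ^ (ϖ - q) * (|u x| ^ q + |v x| ^ q)) := by
    refine norm_integral_le_of_norm_le (μ := Ω.measure) (f := fun x => f x (u x) * v x)
      ((hv1.const_mul _).add (hsum.const_mul _)) ?_
    filter_upwards [ae_restrict_mem Ω.isOpen.measurableSet] with x hx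
    rw [norm_mul, Real.norm_eq_abs, Real.norm_eq_abs]
    have h2 := rpow_sub_one_mul_le (abs_nonneg (u x)) (abs_nonneg (v x)) hT0 hϖ hϖq'.le
    calc |f x (u x)| * |v x| ≤ C₀ * (1 + |u x| ^ (ϖ - 1)) * |v x| := by
          gcongr
          exact hg x hx _
      _ = C₀ * (|v x| + |u x| ^ (ϖ - 1) * |v x|) := by ring
      _ ≤ C₀ * (|v x| + (T ^ (ϖ - 1) * |v x| + T ^ (ϖ - q) * (|u x| ^ q + |v x| ^ q))) := by
          gcongr
      _ = _ := by ring
  rw [integral_add (hv1.const_mul _) (hsum.const_mul _), integral_const_mul, integral_const_mul,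
    integral_add hiu hiv] at h1
  have h3 : C₀ * (1 + T ^ (ϖ - 1)) * ∫ x in Ω.carrier, |v x| ≤ ε / 2 := by
    rwa [le_div_iff₀' hL] at hv2
  have h4 : C₀ * T ^ (ϖ - q) * ((∫ x in Ω.carrier, |u x| ^ q) + ∫ x in Ω.carrier, |v x| ^ q) ≤
      C₀ * T ^ (ϖ - q) * A := by
    gcongr
    linarith [hbd u hu, hbd v hv]
  linarith

theorem SubcriticalGrowth.hasConvergentSubsequence (hM : IsKirchhoffCoefficient M)
    (hpos : ∀ t, 0 < t → 0 < M t) (hf : SubcriticalGrowth Ω p f ϖ) {u : ℕ → W0 Ω p}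
    (hb : Bornology.IsBounded (range u)) (hd : ∀ n, DifferentiableAt ℝ (energy Ω p M f) (u n))
    (hlim : Tendsto (fun n => ‖fderiv ℝ (energy Ω p M f) (u n)‖) atTop (𝓝 0)) :
    HasConvergentSubsequence u := by
  have hp0 : 0 < p := zero_lt_one.trans hp.out
  obtain ⟨B, hB⟩ := hb.exists_norm_le
  have hB' : ∀ n, ‖u n‖ ≤ B := fun n => hB _ (mem_range_self n)
  have hB0 : 0 ≤ B := (norm_nonneg _).trans (hB' 0)
  obtain ⟨σ, hσ, hcau⟩ := W0.exists_subseq_cauchy u hB'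
  obtain ⟨ℓ, hℓ, τ, hτ, hnorm⟩ := isCompact_Icc.tendsto_subseq
    (fun n => (⟨norm_nonneg _, hB' _⟩ : ‖u (σ n)‖ ∈ Icc 0 B))
  set w : ℕ → W0 Ω p := u ∘ (σ ∘ τ) with hw
  have hwn : Tendsto (fun n => ‖w n‖) atTop (𝓝 ℓ) := hnorm
  suffices h : ∃ v, Tendsto w atTop (𝓝 v) by
    obtain ⟨v, hv⟩ := h
    exact ⟨v, σ ∘ τ, hσ.comp hτ, hv⟩
  rcases hℓ.1.eq_or_lt with h0 | hℓ0
  -- Vanishing norms already give convergence, so `M` is only evaluated near `ℓ ^ p > 0` below.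
  · exact ⟨0, tendsto_zero_iff_norm_tendsto_zero.2 (by rwa [h0])⟩
  have hwB : ∀ n, ‖w n‖ ≤ B := fun n => hB' _
  have hwd : ∀ n, DifferentiableAt ℝ (energy Ω p M f) (w n) := fun n => hd _
  have hwlim : Tendsto (fun n => ‖fderiv ℝ (energy Ω p M f) (w n)‖) atTop (𝓝 0) :=
    hlim.comp (hσ.comp hτ).tendsto_atTop
  have hℓp : 0 < ℓ ^ p := Real.rpow_pos_of_pos hℓ0 p
  set μ := M (ℓ ^ p) with hμ
  have hμ0 : 0 < μ := hpos _ hℓp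
  have hMlim : Tendsto (fun n => M (‖w n‖ ^ p)) atTop (𝓝 μ) :=
    ((hM.continuousOn.continuousAt (Ioi_mem_nhds hℓp)).tendsto).comp
      (hwn.rpow_const (Or.inl hℓ0.ne'))
  have hmid : ∀ η : ℝ, 0 < η → ∃ n₀, ∀ m ≥ n₀, ∀ n ≥ n₀,
      ‖w m‖ ^ p - ‖(1 / 2 : ℝ) • (w m + w n)‖ ^ p ≤ η := by
    intro η hη
    -- Chosen so that `p (ε + ε) = μ η`: one `ε` for `J'(w_m)v`, one for the nonlinear term. The
    -- factor `2 M(‖w_m‖ ^ p) > μ` then cancels `μ`.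
    set ε := μ * η / (2 * p) with hε
    have hε0 : 0 < ε := by positivity
    obtain ⟨δ, hδ0, hδ⟩ := hf.exists_abs_integral_mul_le (2 * B) hε0
    obtain ⟨n₁, hn₁⟩ := hcau δ hδ0
    have hev : ∀ᶠ m in atTop, μ / 2 < M (‖w m‖ ^ p) ∧ 0 < ‖w m‖ ∧
        ‖fderiv ℝ (energy Ω p M f) (w m)‖ < ε / (2 * B + 1) :=
      (hMlim.eventually_const_lt (half_lt_self hμ0)).and
        ((hwn.eventually_const_lt hℓ0).and (hwlim.eventually_lt_const (by positivity)))
    obtain ⟨n₂, hn₂⟩ := eventually_atTop.1 hev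
    refine ⟨max n₁ n₂, fun m hm n hn => ?_⟩
    obtain ⟨hm1, hm2, hm3⟩ := hn₂ m ((le_max_right _ _).trans hm)
    set v := w n - w m with hv
    have hvB : ‖v‖ ≤ 2 * B := (norm_sub_le _ _).trans (by linarith [hwB n, hwB m])
    have h1 := hf.norm_rpow_sub_midpoint_le hM hpos (norm_pos_iff.1 hm2) (hwd m) v
    have e1 : w m + (1 / 2 : ℝ) • v = (1 / 2 : ℝ) • (w m + w n) := by
      rw [hv]
      module
    rw [e1] at h1
    have h2 : |∫ x in Ω.carrier, f x (w m x) * v x| ≤ ε := by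
      refine hδ (w m) v ((hwB m).trans (by linarith)) hvB ?_
      exact hn₁ (τ n) (((le_max_left _ _).trans hn).trans hτ.le_apply) (τ m)
        (((le_max_left _ _).trans hm).trans hτ.le_apply)
    have h3 : |fderiv ℝ (energy Ω p M f) (w m) v| ≤ ε := by
      refine ((fderiv ℝ (energy Ω p M f) (w m)).le_opNorm v).trans ?_
      calc _ ≤ ε / (2 * B + 1) * (2 * B + 1) := by
            gcongr
            linarith
        _ = ε := div_mul_cancel₀ _ (by positivity)
    have h4 : p * |fderiv ℝ (energy Ω p M f) (w m) v + ∫ x in Ω.carrier, f x (w m x) * v x| ≤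
        μ * η := by
      calc _ ≤ p * (ε + ε) := by
            gcongr
            exact (abs_add_le _ _).trans (add_le_add h3 h2)
        _ = μ * η := by
            rw [hε]
            field_simp
            ring
    by_contra! hlt
    have h5 : μ * η < 2 * M (‖w m‖ ^ p) * (‖w m‖ ^ p - ‖(1 / 2 : ℝ) • (w m + w n)‖ ^ p) := by
      have : μ < 2 * M (‖w m‖ ^ p) := by linarith
      exact mul_lt_mul'' this hlt hμ0.le hη.le
    linarith
  refine cauchySeq_tendsto_of_complete (Metric.cauchySeq_iff.2 fun ε hε => ?_)
  have hεp : 0 < ε ^ p := Real.rpow_pos_of_pos hε p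
  -- The two terms of the uniform convexity estimate become at most `ε ^ p / 2` and `ε ^ p / 4`,
  -- which leaves a strict inequality.
  set θ := ε ^ p / (4 * (B ^ p + 1)) with hθ
  have hθ0 : 0 < θ := by positivity
  obtain ⟨C, hC0, hC⟩ := W0.exists_uniform_convexity (Ω := Ω) (p := p) hθ0
  obtain ⟨n₀, hn₀⟩ := hmid (ε ^ p / (4 * (C + 1))) (by positivity)
  refine ⟨n₀, fun m hm n hn => ?_⟩
  have h1 := hn₀ m hm n hn
  have h2 := hn₀ n hn m hm
  rw [add_comm (w n) (w m)] at h2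
  have h3 : (‖w m‖ ^ p + ‖w n‖ ^ p) / 2 - ‖(1 / 2 : ℝ) • (w m + w n)‖ ^ p ≤
      ε ^ p / (4 * (C + 1)) := by linarith
  have h4 (k : ℕ) : ‖w k‖ ^ p ≤ B ^ p := Real.rpow_le_rpow (norm_nonneg _) (hwB k) hp0.le
  have h5 : θ * (‖w m‖ ^ p + ‖w n‖ ^ p) ≤ ε ^ p / 2 := by
    calc _ ≤ θ * (2 * (B ^ p + 1)) := by
          gcongr
          linarith [h4 m, h4 n]
      _ = ε ^ p / 2 := by
          rw [hθ]
          field_simp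
          ring
  have h6 : C * ((‖w m‖ ^ p + ‖w n‖ ^ p) / 2 - ‖(1 / 2 : ℝ) • (w m + w n)‖ ^ p) ≤ ε ^ p / 4 := by
    calc _ ≤ C * (ε ^ p / (4 * (C + 1))) := by gcongr
      _ ≤ (C + 1) * (ε ^ p / (4 * (C + 1))) := by
          gcongr
          linarith
      _ = ε ^ p / 4 := by field_simp
  have h7 : ‖w m - w n‖ ^ p < ε ^ p := by linarith [hC (w m) (w n)]
  rw [dist_eq_norm]
  exact (Real.rpow_lt_rpow_iff (norm_nonneg _) hε.le hp0).1 h7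

end Compactness

theorem IsCeramiSequence.isPSSequence {X : Type*} [NormedAddCommGroup X] [NormedSpace ℝ X]
    {J : X → ℝ} {u : ℕ → X} (h : IsCeramiSequence J u) : IsPSSequence J u := by
  refine ⟨h.1, h.2.1, squeeze_zero (fun n => norm_nonneg _) (fun n => ?_) h.2.2⟩
  exact le_mul_of_one_le_left (norm_nonneg _) (by linarith [norm_nonneg (u n)])

end Kirchhoff

theorem proposition4p1 {N : ℕ} [NeZero N] (Ω : Kirchhoff.BoundedDomain N)
    (p : ℝ) [Fact (1 < p)]
    (M : ℝ → ℝ) (hM : Kirchhoff.IsKirchhoffCoefficient M)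
    (f : Kirchhoff.Space N → ℝ → ℝ) (ϖ : ℝ) (hf : Kirchhoff.SubcriticalGrowth Ω p f ϖ) :
    ((Kirchhoff.ConditionAR Ω p M f ∨ Kirchhoff.ConditionC p M ϖ) →
      (∀ u : ℕ → Kirchhoff.W0 Ω p,
        Kirchhoff.IsPSSequence (Kirchhoff.energy Ω p M f) u →
          Bornology.IsBounded (Set.range u)) ∧
      ((∀ t : ℝ, 0 < t → 0 < M t) →
        Kirchhoff.PSCondition (Kirchhoff.energy Ω p M f))) ∧
    ((Kirchhoff.ConditionARWeak Ω p M f ∨ Kirchhoff.ConditionC p M ϖ) →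
      (∀ u : ℕ → Kirchhoff.W0 Ω p,
        Kirchhoff.IsCeramiSequence (Kirchhoff.energy Ω p M f) u →
          Bornology.IsBounded (Set.range u)) ∧
      ((∀ t : ℝ, 0 < t → 0 < M t) →
        Kirchhoff.CeramiCondition (Kirchhoff.energy Ω p M f))) := by
  constructor
  · intro h
    have hb : ∀ u : ℕ → Kirchhoff.W0 Ω p,
        Kirchhoff.IsPSSequence (Kirchhoff.energy Ω p M f) u →
          Bornology.IsBounded (Set.range u) := by
      intro u hu
      rcases h with h | h
      · exact hf.isBounded_of_isPSSequence hM h hu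
      · exact hf.isBounded_of_coercive h hu.1.choose_spec
    exact ⟨hb, fun hpos u hu => hf.hasConvergentSubsequence hM hpos (hb u hu) hu.2.1 hu.2.2⟩
  · intro h
    have hb : ∀ u : ℕ → Kirchhoff.W0 Ω p,
        Kirchhoff.IsCeramiSequence (Kirchhoff.energy Ω p M f) u →
          Bornology.IsBounded (Set.range u) := by
      intro u hu
      rcases h with h | h
      · exact hf.isBounded_of_isCeramiSequence hM h hu
      · exact hf.isBounded_of_coercive h hu.1.choose_spec
    exact ⟨hb, fun hpos u hu => hf.hasConvergentSubsequence hM hpos (hb u hu)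
      hu.isPSSequence.2.1 hu.isPSSequence.2.2⟩
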